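/- **Setting.** Fix a linearly ordered set $\mathrm{PROP}$ of proposition symbols with a set $\mathrm{PROP}_1\subseteq\mathrm{PROP}$ of *distinguished* symbols, and an infinite linearly ordered set $\mathrm{VAR}$ of schema variables. For a finite $\Pi\subseteq\mathrm{PROP}$ let $\Pi_1=\Pi\cap\mathrm{PROP}_1$. *Models.* A Kripke model over $\Pi$ is $M=(W,R,V)$ with $W\neq\emptyset$, $R\subseteq W\times W$, $V:\Pi\to\mathcal P(W)$. The identifier of $w\in W$ is the $|\Pi_1|$-bit string of the truth values at $w$ of the symbols of $\Pi_1$ in increasing order; $M$ is a model with identifiers if distinct nodes have distinct identifiers. The $i$th neighbour of $w$ is the $i$th successor of $w$ in the lexicographic order of identifiers. *Programs.* Schemata are built from $\top$, symbols $p\in\Pi$, schema variables, $\neg$, $\wedge$ and diamonds: the single diamond $\Diamond$ in $\mathrm{MSC}$, the diamonds $\Diamond_1,\Diamond_2,\dots$ in $\mathrm{MPMSC}$. Here $\Diamond\varphi$ says that $\varphi$ holds at some successor, and $\Diamond_i\varphi$ that the $i$th neighbour exists and satisfies $\varphi$. A $\Pi$-program has a finite nonempty set of head predicates $Y\in\mathrm{VAR}$,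 and sets of attention and print predicates among them. Each $Y$ has a terminal clause $Y(0):=\varphi$, where $\varphi$ contains no schema variables, and an iteration clause, whose schema variables are head predicates. In $\mathrm{MSC}$ the iteration clauses have the form $Y:=\chi$; in $\mathrm{MPMSC}$ they have the form $Y:=_{\varphi_1,\dots,\varphi_n}\psi_1;\dots;\psi_n;\chi$ with $n\ge 0$ (the value is that of $\psi_k$ for the first condition $\varphi_k$ that holds, and that of $\chi$ if none holds), and it is required that terminal bodies and the $\varphi_k$ have modal depth $0$ and that the $\psi_k$ and $\chi$ have modal depth at most $1$. The formula $Y^0$ is the terminal body of $Y$, and $Y^{n+1}$ is obtained from the iteration clause of $Y$ by replacing every head predicate $Z$ by $Z^n$. The program outputs $s$ at $w$ in round $n$ if $n$ is the first round in which $Y^n$ is true at $w$ for some attention predicate $Y$, and $s$ is the string of truth values at $w$ of $Y^n$ for the print predicates $Y$ in the order of $\mathrm{VAR}$. The size of a program is the number of occurrences of proposition symbols, head predicates, $\top,\neg,\wedge$ and diamonds. **Theorem.** There is a constant $C\in\mathbb N$ such that the following holds. Let $\Pi$ be a finite set of proposition symbols and $\Lambda$ a $\Pi$-program of $\mathrm{MPMSC}$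 of size $m$ with maximum diamond subindex $I$ ($I=0$ if there is no diamond). Then there is a $\Pi$-program $\Gamma$ of $\mathrm{MSC}$ of size at most $C\,(I+|\Pi_1|+m)$ such that, for every Kripke model $M$ with identifiers which interprets all proposition symbols occurring in $\Lambda$ and $\Gamma$ and whose set of distinguished symbols is exactly $\Pi_1$, and for every node $w$ of $M$: 1. (equivalence) $\Lambda$ and $\Gamma$ produce the same output at $w$, or neither produces any output at $w$; 2. (computation time) if $\Lambda$ outputs at $w$ in round $n$, then $\Gamma$ outputs at $w$ in some round $n'\le 2^{C|\Pi_1|}\cdot n$. -/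

import Mathlib

universe u v w

namespace ModalSubst

/-! ### Syntax -/

/-- Schemata over the proposition symbols `P`, the schema variables `X` and one diamond for each
`d : D`.  With `D = Unit` there is a single plain diamond; with `D = ℕ+` there are the numbered
diamonds `◇₁, ◇₂, …`. -/
inductive Schema (P : Type u) (X : Type v) (D : Type) : Type (max u v)
  | top : Schema P X D
  | prop : P → Schema P X D
  | var : X → Schema P X D
  | neg : Schema P X D → Schema P X D
  | and : Schema P X D → Schema P X D → Schema P X D
  | dia : D → Schema P X D → Schema P X D

/-- Modal formulas: schemata without schema variables. -/
abbrev Formula (P : Type u) (D : Type) : Type u := Schema P Empty D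

namespace Schema

variable {P : Type u} {X : Type v} {D : Type}

/-- `φ ∨ ψ`, as an abbreviation of `¬(¬φ ∧ ¬ψ)`. -/
def or (φ ψ : Schema P X D) : Schema P X D := neg (and (neg φ) (neg ψ))

/-- Simultaneous replacement of every schema variable by a formula. -/
def subst (σ : X → Formula P D) : Schema P X D → Formula P D
  | top => top
  | prop p => prop p
  | var Y => σ Y
  | neg φ => neg (subst σ φ)
  | and φ ψ => and (subst σ φ) (subst σ ψ)
  | dia d φ => dia d (subst σ φ)

/-- The number of occurrences of proposition symbols, schema variables, `⊤`, `¬`, `∧` and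
diamonds. -/
def length : Schema P X D → ℕ
  | top => 1
  | prop _ => 1
  | var _ => 1
  | neg φ => φ.length + 1
  | and φ ψ => φ.length + ψ.length + 1
  | dia _ φ => φ.length + 1

/-- Modal depth: the maximum nesting depth of diamonds. -/
def md : Schema P X D → ℕ
  | top => 0
  | prop _ => 0
  | var _ => 0
  | neg φ => φ.md
  | and φ ψ => max φ.md ψ.md
  | dia _ φ => φ.md + 1

/-- The set of proposition symbols that occur in a schema. -/
def props : Schema P X D → Set P
  | top => ∅
  | prop p => {p}
  | var _ => ∅
  | neg φ => φ.props
  | and φ ψ => φ.props ∪ ψ.props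
  | dia _ φ => φ.props

/-- The maximum subindex of a diamond in a schema (`0` if there is no diamond). -/
def maxIndex : Schema P X ℕ+ → ℕ
  | top => 0
  | prop _ => 0
  | var _ => 0
  | neg φ => φ.maxIndex
  | and φ ψ => max φ.maxIndex ψ.maxIndex
  | dia i φ => max (i : ℕ) φ.maxIndex

end Schema

/-- The right-hand side `:=_{φ₁, …, φₙ} ψ₁; …; ψₙ; χ` of an iteration clause: `branches` is the list
of the pairs (condition `φᵢ`, consequence `ψᵢ`) and `backup` is `χ`.  With no branches this is the
right-hand side `:= χ` of a standard iteration clause. -/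
structure Clause (P : Type u) (X : Type v) (D : Type) where
  branches : List (Schema P X D × Schema P X D)
  backup : Schema P X D

namespace Clause

variable {P : Type u} {X : Type v} {D : Type}

/-- The remaining disjuncts of the iteration formula, `neg` being the conjunction of the negations
of the conditions passed so far. -/
def unfoldAux (neg : Formula P D) :
    List (Formula P D × Formula P D) → Formula P D → Formula P D
  | [], χ => .and neg χ
  | (φ, ψ) :: bs, χ => .or (.and neg (.and φ ψ)) (unfoldAux (.and neg (.neg φ)) bs χ)

/-- The formula
`⋁ₖ ((⋀_{j<k} ¬φⱼ) ∧ φₖ ∧ ψₖ) ∨ ((⋀ⱼ ¬φⱼ) ∧ χ)`, which is just `χ` if there are no conditions. -/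
def unfold : List (Formula P D × Formula P D) → Formula P D → Formula P D
  | [], χ => χ
  | (φ, ψ) :: bs, χ => .or (.and φ ψ) (unfoldAux (.neg φ) bs χ)

/-- The next iteration formula that the clause gives, when the current iteration formulas of the
schema variables are `σ`. -/
def next (σ : X → Formula P D) (c : Clause P X D) : Formula P D :=
  unfold (c.branches.map fun b => (b.1.subst σ, b.2.subst σ)) (c.backup.subst σ)

/-- The number of symbol occurrences in the conditions, the consequences and the backup. -/
def length (c : Clause P X D) : ℕ :=
  (c.branches.map fun b => b.1.length + b.2.length).sum + c.backup.length

/-- The proposition symbols that occur in the clause. -/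
def props (c : Clause P X D) : Set P :=
  {p | (∃ b ∈ c.branches, p ∈ b.1.props ∨ p ∈ b.2.props) ∨ p ∈ c.backup.props}

/-- The maximum subindex of a diamond in the clause (`0` if there is no diamond). -/
def maxIndex (c : Clause P X ℕ+) : ℕ :=
  max ((c.branches.map fun b => max b.1.maxIndex b.2.maxIndex).foldr max 0) c.backup.maxIndex

end Clause

/-- A program with finite nonempty set `heads` of head predicates.  Each head predicate `Y` has the
terminal clause `Y(0) := term Y`, whose body contains no schema variables, and the (possibly
conditional) iteration clause `Y := iter Y`, in which only head predicates occur as schema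
variables. -/
structure Program (P : Type u) (VAR : Type v) (D : Type) where
  heads : Finset VAR
  heads_nonempty : heads.Nonempty
  term : {Y // Y ∈ heads} → Formula P D
  iter : {Y // Y ∈ heads} → Clause P {Y // Y ∈ heads} D
  attention : Finset {Y // Y ∈ heads}
  print : Finset {Y // Y ∈ heads}

namespace Program

variable {P : Type u} {VAR : Type v} {D : Type}

/-- The `n`th iteration formula `Yⁿ` of the head predicate `Y`. -/
def iterFormula (Λ : Program P VAR D) : ℕ → {Y // Y ∈ Λ.heads} → Formula P D
  | 0, Y => Λ.term Y
  | n + 1, Y => (Λ.iter Y).next (Λ.iterFormula n)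

/-- The length (size) of a program: the number of occurrences of proposition symbols, head
predicates (also to the left of `:=`), `⊤`, `¬`, `∧` and diamonds. -/
def length (Λ : Program P VAR D) : ℕ :=
  ∑ Y, ((1 + (Λ.term Y).length) + (1 + (Λ.iter Y).length))

/-- The proposition symbols that occur in a program. -/
def props (Λ : Program P VAR D) : Set P :=
  {p | ∃ Y, p ∈ (Λ.term Y).props ∨ p ∈ (Λ.iter Y).props}

/-- The maximum subindex of a diamond in a program (`0` if there is no diamond). -/
def maxIndex (Λ : Program P VAR ℕ+) : ℕ :=
  Finset.univ.sup fun Y => max (Λ.term Y).maxIndex (Λ.iter Y).maxIndex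

/-- The program is a program of MSC: it has only the plain diamond, and no conditional rules. -/
def IsMSC (Λ : Program P VAR Unit) : Prop :=
  ∀ Y, (Λ.iter Y).branches = []

/-- The program is a program of message passing MSC: it has only numbered diamonds, terminal
clauses and conditions have modal depth `0`, and consequences, backups and bodies of standard
iteration clauses have modal depth at most `1`. -/
def IsMPMSC (Λ : Program P VAR ℕ+) : Prop :=
  ∀ Y, (Λ.term Y).md = 0 ∧
    (∀ b ∈ (Λ.iter Y).branches, b.1.md = 0 ∧ b.2.md ≤ 1) ∧
    (Λ.iter Y).backup.md ≤ 1

/-- The program is a program over the set `S` of proposition symbols. -/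
def IsOver (Λ : Program P VAR D) (S : Finset P) : Prop := Λ.props ⊆ S

end Program

/-! ### Kripke models with identifiers -/

open Classical in
/-- The distinguished proposition symbols in `S`, where `PROP₁` is the set of all distinguished
proposition symbols. -/
noncomputable def distinguished {P : Type u} (PROP₁ : Set P) (S : Finset P) : Finset P :=
  S.filter (· ∈ PROP₁)

/-- Kripke models over the set `S` of proposition symbols. -/
structure KripkeModel {P : Type u} (S : Finset P) where
  W : Type w
  nonempty : Nonempty W
  R : W → W → Prop
  V : {p // p ∈ S} → Set W

namespace KripkeModel

variable {P : Type u} {S : Finset P}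

/-- The symbol `p` is true at `x` (false if the model does not interpret `p`). -/
def Holds (M : KripkeModel.{u, w} S) (x : M.W) (p : P) : Prop :=
  ∃ h : p ∈ S, x ∈ M.V ⟨p, h⟩

open Classical in
/-- The identifier of a node: the string of the truth values of the distinguished symbols, which
are taken in increasing order. -/
noncomputable def ident [LinearOrder P] (M : KripkeModel.{u, w} S) (PROP₁ : Set P) (x : M.W) :
    List Bool :=
  ((distinguished PROP₁ S).sort (· ≤ ·)).map fun p => decide (M.Holds x p)

/-- The model is a model with identifiers: distinct nodes have distinct identifiers. -/
def HasIdentifiers [LinearOrder P] (M : KripkeModel.{u, w} S) (PROP₁ : Set P) : Prop :=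
  Function.Injective (M.ident PROP₁)

/-- The accessibility relation, as interpretation of the plain diamond. -/
def plainAcc (M : KripkeModel.{u, w} S) : Unit → M.W → M.W → Prop :=
  fun _ => M.R

/-- The interpretation of the numbered diamonds: `y` is the `i`th neighbour of `x`, that is, a
successor of `x` such that exactly `i - 1` successors of `x` have a lexicographically smaller
identifier.  (Used only for models with identifiers, which are finite.) -/
def numberedAcc [LinearOrder P] (M : KripkeModel.{u, w} S) (PROP₁ : Set P) :
    ℕ+ → M.W → M.W → Prop :=
  fun i x y => M.R x y ∧
    {z | M.R x z ∧ M.ident PROP₁ z < M.ident PROP₁ y}.ncard + 1 = (i : ℕ)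

/-- Truth of a formula at a node, the diamonds being interpreted by the relations `acc`. -/
def Sat {D : Type} (M : KripkeModel.{u, w} S) (acc : D → M.W → M.W → Prop) :
    M.W → Formula P D → Prop
  | _, .top => True
  | x, .prop p => M.Holds x p
  | x, .neg φ => ¬ Sat M acc x φ
  | x, .and φ ψ => Sat M acc x φ ∧ Sat M acc x ψ
  | x, .dia d φ => ∃ y, acc d x y ∧ Sat M acc y φ

end KripkeModel

/-! ### Acceptance and output -/

/-- A sequence `b` of strings of bits, with positions in `ι`, accepts in round `n` with respect to
the attention positions `A`: some attention bit is `1` in round `n`, and none is in any earlier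
round. -/
def Accepts {ι : Type v} (b : ℕ → ι → Bool) (A : Finset ι) (n : ℕ) : Prop :=
  (∃ i ∈ A, b n i = true) ∧ ∀ m < n, ∀ i ∈ A, b m i = false

namespace Program

variable {P : Type u} {VAR : Type v} {D : Type} {S : Finset P}

open Classical in
/-- The global configurations: in round `n` at the node `x`, the bit of the head predicate `Y` is
`1` iff `Yⁿ` is true at `x`. -/
noncomputable def config (Λ : Program P VAR D) (M : KripkeModel.{u, w} S)
    (acc : D → M.W → M.W → Prop) (x : M.W) (n : ℕ) (Y : {Y // Y ∈ Λ.heads}) : Bool :=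
  decide (M.Sat acc x (Λ.iterFormula n Y))

/-- The node `x` outputs the string `s` in round `n`: it accepts in round `n`, and `s` is the string
of the print bits of round `n`, in the order of the schema variables. -/
def OutputsIn [LinearOrder VAR] (Λ : Program P VAR D) (M : KripkeModel.{u, w} S)
    (acc : D → M.W → M.W → Prop) (x : M.W) (s : List Bool) (n : ℕ) : Prop :=
  Accepts (Λ.config M acc x) Λ.attention n ∧
    s = (Λ.print.sort (· ≤ ·)).map (Λ.config M acc x n)

/-- A model over `S` is suitable for the program if it interprets all proposition symbols that
occur in the program. -/
def Suitable (Λ : Program P VAR D) {S : Finset P} (_M : KripkeModel.{u, w} S) : Prop :=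
  Λ.props ⊆ S

/-- Acceptance equivalence of a program `Λ` with numbered diamonds and a program `Γ` with plain
diamonds, for identifiers over the distinguished symbols of `S`: on every model that has such
identifiers and is suitable for both programs, at every node, both programs have the same output or
both have none. -/
def Equivalent [LinearOrder P] [LinearOrder VAR] (PROP₁ : Set P) (S : Finset P)
    (Λ : Program P VAR ℕ+) (Γ : Program P VAR Unit) : Prop :=
  ∀ (S' : Finset P), distinguished PROP₁ S' = distinguished PROP₁ S →
    ∀ M : KripkeModel.{u, w} S', M.HasIdentifiers PROP₁ → Λ.Suitable M → Γ.Suitable M →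
      ∀ (x : M.W) (s : List Bool),
        (∃ n, Λ.OutputsIn M (M.numberedAcc PROP₁) x s n) ↔ ∃ n, Γ.OutputsIn M M.plainAcc x s n

/-- The computation time of `Γ` is at most `T` times that of `Λ`: on every model as above, if `Λ`
outputs at a node in round `n`, then `Γ` outputs there in a round `n' ≤ T * n`. -/
def TimeAtMost [LinearOrder P] [LinearOrder VAR] (PROP₁ : Set P) (S : Finset P)
    (Λ : Program P VAR ℕ+) (Γ : Program P VAR Unit) (T : ℕ) : Prop :=
  ∀ (S' : Finset P), distinguished PROP₁ S' = distinguished PROP₁ S →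
    ∀ M : KripkeModel.{u, w} S', M.HasIdentifiers PROP₁ → Λ.Suitable M → Γ.Suitable M →
      ∀ (x : M.W) (s : List Bool) (n : ℕ), Λ.OutputsIn M (M.numberedAcc PROP₁) x s n →
        ∃ n' ≤ T * n, Γ.OutputsIn M M.plainAcc x s n'

end Program

end ModalSubst

/-! Let `k` be the number of distinguished symbols. A plain diamond cannot tell successors apart, so
the nodes are made to speak one at a time, in the order of their identifiers. On strings of equal
length the lexicographic order is the numerical one (`lt_iff_binary_lt`). Hence it suffices that all
nodes run the same `k`-bit counter through `0, …, 2 ^ k - 1`, and that a node marks itself active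
when the counter shows its own identifier. At most one node is active at a time, so `◇(active ∧ φ)`
asks a single successor about `φ`; bodies of diamonds have modal depth 0, so that node can answer at
once. Each node counts in unary the active successors it has seen, up to the maximal subindex. An
active successor is the `i`th neighbour iff exactly `i - 1` were counted before it
(`numberedAcc_iff`, `HasIdentifiers.le_below_add_one`); then its answer is stored. After a full pass
every numbered diamond of the iteration clauses is a stored bit, and the heads of `Λ`, frozen during
the pass, are updated together.

The size stays linear for four reasons: the carry of the counter moves by one bit per phase, whence
`k + 2` phases per counter value; the unary count is shared by all diamonds; every diamond body is
copied once; and conditional clauses become nested conditionals.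

Correctness is one invariant, `simState`, preserved in each round by `eval_simBody`. Round `n` of
`Λ` is spread over `T = (k + 2) * 2 ^ k` rounds, and `outputsIn_ofEmbedding_iff` concludes that
outputs move from round `n` to round `T * n`. If `k = 0`, models have one node and a direct
translation works (`exists_plain_of_distinguished_eq_empty`). -/

namespace ModalSubst

/-! ### Operations on schemata -/

namespace Schema

universe v'

variable {P : Type u} {X : Type v} {X' : Type v'} {D D' : Type}

/-- `if c then φ else ψ`. -/
def ite (c φ ψ : Schema P X D) : Schema P X D := or (and c φ) (and (neg c) ψ)

/-- `φ ↔ ψ`. -/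
def iff (φ ψ : Schema P X D) : Schema P X D := and (neg (and φ (neg ψ))) (neg (and (neg φ) ψ))

/-- The conjunction of a list of schemata. -/
def conj (l : List (Schema P X D)) : Schema P X D := l.foldr and top

/-- Replacement of the variables and of the outermost diamond subschemata. -/
def trans (f : X → Schema P X' D') (g : D → Schema P X D → Schema P X' D') :
    Schema P X D → Schema P X' D'
  | top => top
  | prop p => prop p
  | var Y => f Y
  | neg φ => neg (trans f g φ)
  | and φ ψ => and (trans f g φ) (trans f g ψ)
  | dia d φ => g d φ

/-- Renaming of the variables. -/
def rename (f : X → X') : Schema P X D → Schema P X' D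
  | top => top
  | prop p => prop p
  | var Y => var (f Y)
  | neg φ => neg (rename f φ)
  | and φ ψ => and (rename f φ) (rename f ψ)
  | dia d φ => dia d (rename f φ)

/-- The outermost diamond subschemata, each given by its diamond and its body. -/
def dias : Schema P X D → List (D × Schema P X D)
  | top => []
  | prop _ => []
  | var _ => []
  | neg φ => φ.dias
  | and φ ψ => φ.dias ++ ψ.dias
  | dia d φ => [(d, φ)]

lemma length_pos (φ : Schema P X D) : 1 ≤ φ.length := by
  cases φ <;> simp [length]

lemma length_or (φ ψ : Schema P X D) : (or φ ψ).length = φ.length + ψ.length + 4 := by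
  simp only [or, length]; ring

lemma length_ite (c φ ψ : Schema P X D) :
    (ite c φ ψ).length = 2 * c.length + φ.length + ψ.length + 7 := by
  simp only [ite, length, length_or]; ring

lemma length_iff (φ ψ : Schema P X D) :
    (iff φ ψ).length = 2 * φ.length + 2 * ψ.length + 7 := by
  simp only [iff, length]; ring

lemma length_conj_le {c : ℕ} (l : List (Schema P X D)) (h : ∀ φ ∈ l, φ.length ≤ c) :
    (conj l).length ≤ (c + 1) * l.length + 1 := by
  induction l with
  | nil => simp [conj, length]
  | cons φ l ih =>
    have h₁ := h φ (by simp)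
    have h₂ := ih fun ψ hψ => h ψ (by simp [hψ])
    simp only [conj, List.foldr_cons, length, List.length_cons] at h₂ ⊢
    linarith

lemma length_trans_le {f : X → Schema P X' D'} {g : D → Schema P X D → Schema P X' D'}
    (hf : ∀ Y, (f Y).length ≤ 1) (hg : ∀ d φ, (g d φ).length ≤ φ.length + 1)
    (φ : Schema P X D) : (φ.trans f g).length ≤ φ.length := by
  induction φ with
  | top => simp [trans, length]
  | prop p => simp [trans, length]
  | var Y => simpa [trans, length] using hf Y
  | neg φ ih => simpa [trans, length] using ih
  | and φ ψ ih₁ ih₂ => simp only [trans, length]; omega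
  | dia d φ => simpa [trans, length] using hg d φ

lemma length_rename (f : X → X') (φ : Schema P X D) : (φ.rename f).length = φ.length := by
  induction φ <;> simp_all [rename, length]

lemma sum_dias_le (φ : Schema P X D) :
    (φ.dias.map fun d => d.2.length + 1).sum ≤ φ.length := by
  induction φ with
  | top => simp [dias]
  | prop p => simp [dias]
  | var Y => simp [dias]
  | neg φ ih => simp only [dias, length]; omega
  | and φ ψ ih₁ ih₂ => simp only [dias, length, List.map_append, List.sum_append]; omega
  | dia d φ => simp [dias, length]

lemma dias_eq_nil {φ : Schema P X D} (h : φ.md = 0) : φ.dias = [] := by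
  induction φ with
  | top => rfl
  | prop p => rfl
  | var Y => rfl
  | neg φ ih => exact ih h
  | and φ ψ ih₁ ih₂ =>
    simp only [md, Nat.max_eq_zero_iff] at h
    simp [dias, ih₁ h.1, ih₂ h.2]
  | dia d φ => simp [md] at h

lemma md_of_mem_dias {φ : Schema P X D} (h : φ.md ≤ 1) : ∀ d ∈ φ.dias, d.2.md = 0 := by
  induction φ with
  | top => simp [dias]
  | prop p => simp [dias]
  | var Y => simp [dias]
  | neg φ ih => exact ih h
  | and φ ψ ih₁ ih₂ =>
    simp only [md, max_le_iff] at h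
    simp only [dias, List.mem_append]
    rintro d (hd | hd)
    exacts [ih₁ h.1 d hd, ih₂ h.2 d hd]
  | dia d φ => simpa [dias, md] using h

lemma le_maxIndex_of_mem_dias {φ : Schema P X ℕ+} : ∀ d ∈ φ.dias, (d.1 : ℕ) ≤ φ.maxIndex := by
  induction φ with
  | top => simp [dias]
  | prop p => simp [dias]
  | var Y => simp [dias]
  | neg φ ih => exact ih
  | and φ ψ ih₁ ih₂ =>
    simp only [dias, List.mem_append, maxIndex]
    rintro d (hd | hd)
    exacts [(ih₁ d hd).trans (le_max_left _ _), (ih₂ d hd).trans (le_max_right _ _)]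
  | dia d φ => simp [dias, maxIndex]

lemma props_of_mem_dias {φ : Schema P X D} : ∀ d ∈ φ.dias, d.2.props ⊆ φ.props := by
  induction φ with
  | top => simp [dias]
  | prop p => simp [dias]
  | var Y => simp [dias]
  | neg φ ih => exact ih
  | and φ ψ ih₁ ih₂ =>
    simp only [dias, List.mem_append, props]
    rintro d (hd | hd)
    exacts [(ih₁ d hd).trans Set.subset_union_left, (ih₂ d hd).trans Set.subset_union_right]
  | dia d φ => simp [dias, props]

lemma props_ite (c φ ψ : Schema P X D) :
    (ite c φ ψ).props = c.props ∪ (φ.props ∪ ψ.props) := by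
  ext p; simp only [ite, or, props, Set.mem_union]; tauto

lemma props_iff (φ ψ : Schema P X D) : (iff φ ψ).props = φ.props ∪ ψ.props := by
  ext p; simp only [iff, props, Set.mem_union]; tauto

lemma props_conj_subset {s : Set P} (l : List (Schema P X D)) (h : ∀ φ ∈ l, φ.props ⊆ s) :
    (conj l).props ⊆ s := by
  induction l with
  | nil => simp [conj, props]
  | cons φ l ih => exact Set.union_subset (h φ (by simp)) (ih fun ψ hψ => h ψ (by simp [hψ]))

lemma props_trans_subset {s : Set P} {f : X → Schema P X' D'}
    {g : D → Schema P X D → Schema P X' D'} (hf : ∀ Y, (f Y).props ⊆ s)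
    (hg : ∀ d φ, φ.props ⊆ s → (g d φ).props ⊆ s)
    (φ : Schema P X D) (h : φ.props ⊆ s) : (φ.trans f g).props ⊆ s := by
  induction φ with
  | top => simp [trans, props]
  | prop p => exact h
  | var Y => exact hf Y
  | neg φ ih => exact ih h
  | and φ ψ ih₁ ih₂ =>
    exact Set.union_subset (ih₁ (Set.subset_union_left.trans h))
      (ih₂ (Set.subset_union_right.trans h))
  | dia d φ => exact hg d φ h

lemma props_rename (f : X → X') (φ : Schema P X D) : (φ.rename f).props = φ.props := by
  induction φ <;> simp_all [rename, props]

end Schema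

/-! ### Conditional clauses as nested conditionals -/

namespace Clause

universe v'

variable {P : Type u} {X : Type v} {X' : Type v'} {D D' : Type}

/-- The single schema equivalent to the conditional clause with components translated by `t`. -/
def flatten (t : Schema P X D → Schema P X' D') (c : Clause P X D) : Schema P X' D' :=
  c.branches.foldr (fun b φ => .ite (t b.1) (t b.2) φ) (t c.backup)

/-- The outermost diamond subschemata of the components of the clause. -/
def dias (c : Clause P X D) : List (D × Schema P X D) :=
  (c.branches.flatMap fun b => b.1.dias ++ b.2.dias) ++ c.backup.dias

/-- A branch `(φ, ψ)` costs `2|φ| + |ψ| + 7`, and `|φ| ≥ 1` pays for the constant. Nesting keeps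
this linear, whereas `unfold` repeats the earlier negated conditions in every disjunct. -/
lemma length_flatten_le {t : Schema P X D → Schema P X' D'} (ht : ∀ φ, (t φ).length ≤ φ.length)
    (c : Clause P X D) : (c.flatten t).length ≤ 9 * c.length := by
  obtain ⟨bs, χ⟩ := c
  induction bs with
  | nil =>
    have := ht χ
    simp only [flatten, length, List.foldr_nil, List.map_nil, List.sum_nil]
    omega
  | cons b bs ih =>
    have h₁ := ht b.1
    have h₂ := ht b.2
    have h₃ := b.1.length_pos
    simp only [flatten, length, List.foldr_cons, List.map_cons, List.sum_cons,
      Schema.length_ite] at ih ⊢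
    omega

lemma sum_dias_le (c : Clause P X D) :
    (c.dias.map fun d => d.2.length + 1).sum ≤ c.length := by
  obtain ⟨bs, χ⟩ := c
  induction bs with
  | nil => simpa [dias, length] using χ.sum_dias_le
  | cons b bs ih =>
    have h₁ := b.1.sum_dias_le
    have h₂ := b.2.sum_dias_le
    simp only [dias, length, List.flatMap_cons, List.map_append, List.sum_append, List.map_cons,
      List.sum_cons] at ih ⊢
    omega

lemma le_maxIndex_of_mem_dias (c : Clause P X ℕ+) : ∀ d ∈ c.dias, (d.1 : ℕ) ≤ c.maxIndex := by
  obtain ⟨bs, χ⟩ := c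
  induction bs with
  | nil => simpa [dias, maxIndex] using fun a b => χ.le_maxIndex_of_mem_dias (a, b)
  | cons b bs ih =>
    intro d hd
    simp only [dias, List.flatMap_cons, List.mem_append] at hd
    simp only [maxIndex, List.map_cons, List.foldr_cons]
    have h : d ∈ (⟨bs, χ⟩ : Clause P X ℕ+).dias → (d.1 : ℕ) ≤ _ := ih d
    simp only [dias, maxIndex, List.mem_append, le_max_iff] at h ⊢
    rcases hd with ((hd | hd) | hd) | hd
    · exact .inl (.inl (.inl (b.1.le_maxIndex_of_mem_dias d hd)))
    · exact .inl (.inl (.inr (b.2.le_maxIndex_of_mem_dias d hd)))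
    · tauto
    · tauto

lemma props_subset_iff {c : Clause P X D} {s : Set P} :
    c.props ⊆ s ↔ (∀ b ∈ c.branches, b.1.props ⊆ s ∧ b.2.props ⊆ s) ∧ c.backup.props ⊆ s := by
  refine ⟨fun h => ⟨fun b hb => ⟨fun p hp => h (.inl ⟨b, hb, .inl hp⟩),
    fun p hp => h (.inl ⟨b, hb, .inr hp⟩)⟩, fun p hp => h (.inr hp)⟩, ?_⟩
  rintro ⟨h₁, h₂⟩ p (⟨b, hb, hp | hp⟩ | hp)
  exacts [(h₁ b hb).1 hp, (h₁ b hb).2 hp, h₂ hp]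

lemma props_of_mem_dias (c : Clause P X D) : ∀ d ∈ c.dias, d.2.props ⊆ c.props := by
  have h := props_subset_iff.1 (subset_refl c.props)
  intro d hd
  simp only [dias, List.mem_append, List.mem_flatMap] at hd
  rcases hd with ⟨b, hb, hd | hd⟩ | hd
  · exact (Schema.props_of_mem_dias d hd).trans (h.1 b hb).1
  · exact (Schema.props_of_mem_dias d hd).trans (h.1 b hb).2
  · exact (Schema.props_of_mem_dias d hd).trans h.2

lemma props_flatten_subset {s : Set P} {t : Schema P X D → Schema P X' D'}
    (ht : ∀ φ, φ.props ⊆ s → (t φ).props ⊆ s) (c : Clause P X D) (h : c.props ⊆ s) :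
    (c.flatten t).props ⊆ s := by
  rw [props_subset_iff] at h
  obtain ⟨bs, χ⟩ := c
  induction bs with
  | nil => exact ht _ h.2
  | cons b bs ih =>
    have hb := h.1 b (by simp)
    have := ih ⟨fun b' hb' => h.1 b' (List.mem_cons_of_mem _ hb'), h.2⟩
    simp only [flatten, List.foldr_cons, Schema.props_ite] at this ⊢
    exact Set.union_subset (ht _ hb.1) (Set.union_subset (ht _ hb.2) this)

end Clause

/-! ### Semantics of schemata -/

namespace KripkeModel

universe v'

variable {P : Type u} {S : Finset P} {X : Type v} {X' : Type v'} {D D' : Type}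

/-- Truth of a schema at a node under an interpretation of the schema variables. -/
def Eval (M : KripkeModel.{u, w} S) (acc : D → M.W → M.W → Prop) (ν : X → M.W → Prop) :
    Schema P X D → M.W → Prop
  | .top, _ => True
  | .prop p, x => M.Holds x p
  | .var Y, x => ν Y x
  | .neg φ, x => ¬ Eval M acc ν φ x
  | .and φ ψ, x => Eval M acc ν φ x ∧ Eval M acc ν ψ x
  | .dia d φ, x => ∃ y, acc d x y ∧ Eval M acc ν φ y

/-- Truth of the right-hand side of a clause under an interpretation of the schema variables. -/
def EvalBranches (M : KripkeModel.{u, w} S) (acc : D → M.W → M.W → Prop) (ν : X → M.W → Prop)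
    (χ : Schema P X D) : List (Schema P X D × Schema P X D) → M.W → Prop
  | [], x => M.Eval acc ν χ x
  | b :: bs, x => (M.Eval acc ν b.1 x ∧ M.Eval acc ν b.2 x) ∨
      (¬ M.Eval acc ν b.1 x ∧ EvalBranches M acc ν χ bs x)

variable (M : KripkeModel.{u, w} S) {acc : D → M.W → M.W → Prop} {ν : X → M.W → Prop} {x : M.W}

lemma sat_subst {σ : X → Formula P D} (φ : Schema P X D) (x : M.W) :
    M.Sat acc x (φ.subst σ) ↔ M.Eval acc (fun Y y => M.Sat acc y (σ Y)) φ x := by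
  induction φ generalizing x with
  | top => exact Iff.rfl
  | prop p => exact Iff.rfl
  | var Y => exact Iff.rfl
  | neg φ ih => exact not_congr (ih x)
  | and φ ψ ih₁ ih₂ => exact and_congr (ih₁ x) (ih₂ x)
  | dia d φ ih => exact exists_congr fun y => and_congr Iff.rfl (ih y)

lemma sat_iff_eval (φ : Formula P D) (x : M.W) :
    M.Sat acc x φ ↔ M.Eval acc (fun Y _ => Y.elim) φ x := by
  induction φ generalizing x with
  | top => exact Iff.rfl
  | prop p => exact Iff.rfl
  | var Y => exact Y.elim
  | neg φ ih => exact not_congr (ih x)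
  | and φ ψ ih₁ ih₂ => exact and_congr (ih₁ x) (ih₂ x)
  | dia d φ ih => exact exists_congr fun y => and_congr Iff.rfl (ih y)

lemma sat_or (φ ψ : Formula P D) : M.Sat acc x (.or φ ψ) ↔ M.Sat acc x φ ∨ M.Sat acc x ψ := by
  simp only [Schema.or, Sat]; tauto

@[simp] lemma eval_or (φ ψ : Schema P X D) :
    M.Eval acc ν (.or φ ψ) x ↔ M.Eval acc ν φ x ∨ M.Eval acc ν ψ x := by
  simp only [Schema.or, Eval]; tauto

@[simp] lemma eval_ite (c φ ψ : Schema P X D) :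
    M.Eval acc ν (.ite c φ ψ) x ↔
      (M.Eval acc ν c x ∧ M.Eval acc ν φ x) ∨ (¬ M.Eval acc ν c x ∧ M.Eval acc ν ψ x) := by
  simp only [Schema.ite, eval_or, Eval]

@[simp] lemma eval_iff (φ ψ : Schema P X D) :
    M.Eval acc ν (.iff φ ψ) x ↔ (M.Eval acc ν φ x ↔ M.Eval acc ν ψ x) := by
  simp only [Schema.iff, Eval]; tauto

@[simp] lemma eval_conj (l : List (Schema P X D)) :
    M.Eval acc ν (.conj l) x ↔ ∀ φ ∈ l, M.Eval acc ν φ x := by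
  induction l with
  | nil => simp [Schema.conj, Eval]
  | cons φ l ih => simpa [Schema.conj, Eval] using fun _ => ih

lemma eval_rename (f : X' → X) (φ : Schema P X' D) (x : M.W) :
    M.Eval acc ν (φ.rename f) x ↔ M.Eval acc (fun Y => ν (f Y)) φ x := by
  induction φ generalizing x with
  | top => exact Iff.rfl
  | prop p => exact Iff.rfl
  | var Y => exact Iff.rfl
  | neg φ ih => exact not_congr (ih x)
  | and φ ψ ih₁ ih₂ => exact and_congr (ih₁ x) (ih₂ x)
  | dia d φ ih => exact exists_congr fun y => and_congr Iff.rfl (ih y)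

/-- Since `trans` does not recurse below a diamond, the node `x` stays fixed and only the outermost
diamonds need a hypothesis. Serves `collapse`, `plainTerm` and `simTrans` alike. -/
lemma eval_trans {acc' : D' → M.W → M.W → Prop} {ν' : X' → M.W → Prop} {f : X → Schema P X' D'}
    {g : D → Schema P X D → Schema P X' D'} (φ : Schema P X D)
    (hf : ∀ Y, M.Eval acc' ν' (f Y) x ↔ ν Y x)
    (hg : ∀ d ∈ φ.dias, (M.Eval acc' ν' (g d.1 d.2) x ↔ M.Eval acc ν (.dia d.1 d.2) x)) :
    M.Eval acc' ν' (φ.trans f g) x ↔ M.Eval acc ν φ x := by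
  induction φ with
  | top => exact Iff.rfl
  | prop p => exact Iff.rfl
  | var Y => exact hf Y
  | neg φ ih => exact not_congr (ih hg)
  | and φ ψ ih₁ ih₂ =>
    simp only [Schema.dias, List.mem_append] at hg
    exact and_congr (ih₁ fun d hd => hg d (.inl hd)) (ih₂ fun d hd => hg d (.inr hd))
  | dia d φ => exact hg (d, φ) (by simp [Schema.dias])

/-- The accumulated negations `N` are a conjunct of every later disjunct, so they factor out; the
induction needs `N` arbitrary because it grows with each branch. -/
lemma sat_unfoldAux {σ : X → Formula P D} (χ : Schema P X D)
    (bs : List (Schema P X D × Schema P X D)) (N : Formula P D) :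
    M.Sat acc x (Clause.unfoldAux N (bs.map fun b => (b.1.subst σ, b.2.subst σ)) (χ.subst σ)) ↔
      M.Sat acc x N ∧ M.EvalBranches acc (fun Y y => M.Sat acc y (σ Y)) χ bs x := by
  induction bs generalizing N with
  | nil => simp only [List.map_nil, Clause.unfoldAux, Sat, EvalBranches, sat_subst]
  | cons b bs ih =>
    simp only [List.map_cons, Clause.unfoldAux, sat_or, ih, Sat, EvalBranches, sat_subst]
    tauto

lemma sat_next {σ : X → Formula P D} (c : Clause P X D) :
    M.Sat acc x (c.next σ) ↔
      M.EvalBranches acc (fun Y y => M.Sat acc y (σ Y)) c.backup c.branches x := by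
  obtain ⟨bs, χ⟩ := c
  cases bs with
  | nil => simp only [Clause.next, List.map_nil, Clause.unfold, EvalBranches, sat_subst]
  | cons b bs =>
    simp only [Clause.next, List.map_cons, Clause.unfold, EvalBranches, sat_subst, sat_or,
      sat_unfoldAux, Sat]

lemma eval_flatten {acc' : D' → M.W → M.W → Prop} {ν' : X' → M.W → Prop}
    {t : Schema P X D → Schema P X' D'} (c : Clause P X D)
    (hb : ∀ b ∈ c.branches, (M.Eval acc' ν' (t b.1) x ↔ M.Eval acc ν b.1 x) ∧
      (M.Eval acc' ν' (t b.2) x ↔ M.Eval acc ν b.2 x))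
    (hc : M.Eval acc' ν' (t c.backup) x ↔ M.Eval acc ν c.backup x) :
    M.Eval acc' ν' (c.flatten t) x ↔ M.EvalBranches acc ν c.backup c.branches x := by
  obtain ⟨bs, χ⟩ := c
  induction bs with
  | nil => exact hc
  | cons b bs ih =>
    have h := ih (fun b' hb' => hb b' (List.mem_cons_of_mem _ hb')) hc
    have hb' := hb b (by simp)
    simp only [Clause.flatten, List.foldr_cons, eval_ite, EvalBranches] at h ⊢
    rw [hb'.1, hb'.2, h]

end KripkeModel

/-! ### Programs with plain diamonds -/

namespace Program

variable {P : Type u} {VAR : Type v} {X : Type v} [Fintype X] [Nonempty X]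

/-- The head predicates of `ofEmbedding`. -/
noncomputable def headEquiv (e : X ↪ VAR) : X ≃ {Y // Y ∈ Finset.univ.map e} :=
  Equiv.ofBijective (fun Z => ⟨e Z, by simp⟩)
    ⟨fun Z Z' h => e.injective (congrArg Subtype.val h), fun ⟨Y, hY⟩ => by
      obtain ⟨Z, -, rfl⟩ := Finset.mem_map.1 hY
      exact ⟨Z, rfl⟩⟩

/-- The MSC program whose head predicates are indexed by `X`. -/
noncomputable def ofEmbedding (e : X ↪ VAR) (term : X → Formula P Unit)
    (body : X → Schema P X Unit) (attention print : Finset X) : Program P VAR Unit where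
  heads := Finset.univ.map e
  heads_nonempty := Finset.univ_nonempty.map
  term Y := term ((headEquiv e).symm Y)
  iter Y := ⟨[], (body ((headEquiv e).symm Y)).rename (headEquiv e)⟩
  attention := attention.map (headEquiv e).toEmbedding
  print := print.map (headEquiv e).toEmbedding

variable (e : X ↪ VAR) (term : X → Formula P Unit) (body : X → Schema P X Unit)
  (attention print : Finset X)

lemma isMSC_ofEmbedding : (ofEmbedding e term body attention print).IsMSC := fun _ => rfl

lemma length_ofEmbedding : (ofEmbedding e term body attention print).length =
    ∑ Z, ((1 + (term Z).length) + (1 + (body Z).length)) := by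
  refine ((headEquiv e).sum_comp _).symm.trans (Finset.sum_congr rfl fun Z _ => ?_)
  simp [ofEmbedding, Clause.length, Schema.length_rename]

lemma isOver_ofEmbedding {S : Finset P} (ht : ∀ Z, (term Z).props ⊆ S)
    (hb : ∀ Z, (body Z).props ⊆ S) : (ofEmbedding e term body attention print).IsOver S := by
  rintro p ⟨Y, hp | hp⟩
  · exact ht _ hp
  · rcases hp with ⟨b, hb, -⟩ | hp
    · exact absurd hb List.not_mem_nil
    · exact hb _ ((Schema.props_rename (headEquiv e) _).subset hp)

/-- Reduces the semantics of a program to a guessed invariant `F`: only the start and a single round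
have to be checked. -/
lemma sat_iterFormula_ofEmbedding {S : Finset P} (M : KripkeModel.{u, w} S)
    {acc : Unit → M.W → M.W → Prop} (F : ℕ → X → M.W → Prop)
    (h₀ : ∀ Z x, M.Sat acc x (term Z) ↔ F 0 Z x)
    (h₁ : ∀ t Z x, M.Eval acc (F t) (body Z) x ↔ F (t + 1) Z x) (t : ℕ) (Z : X) (x : M.W) :
    M.Sat acc x ((ofEmbedding e term body attention print).iterFormula t (headEquiv e Z)) ↔
      F t Z x := by
  induction t generalizing Z x with
  | zero => simpa [iterFormula, ofEmbedding] using h₀ Z x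
  | succ t ih =>
    simp only [iterFormula, M.sat_next]
    have : (ofEmbedding e term body attention print).iter (headEquiv e Z) =
        ⟨[], (body Z).rename (headEquiv e)⟩ := by simp [ofEmbedding]
    rw [this]
    refine (M.eval_rename (headEquiv e) (body Z) x).trans ?_
    rw [← h₁]
    simp only [ih]

end Program

/-! ### Identifiers as numbers -/

/-- The number with the given binary digits, the most significant one first. -/
def binary : List Bool → ℕ
  | [] => 0
  | b :: l => 2 ^ l.length * b.toNat + binary l

lemma binary_lt (l : List Bool) : binary l < 2 ^ l.length := by
  induction l with
  | nil => simp [binary]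
  | cons b l ih =>
    simp only [binary, List.length_cons, pow_succ]
    cases b <;> simp <;> omega

/-- By `binary_lt` the leading bit outweighs all later ones together, and equal lengths give the two
leading bits the same weight. -/
lemma lt_iff_binary_lt {l l' : List Bool} (h : l.length = l'.length) :
    l < l' ↔ binary l < binary l' := by
  induction l generalizing l' with
  | nil =>
    cases l' with
    | nil => simp
    | cons b l' => simp at h
  | cons b l ih =>
    cases l' with
    | nil => simp at h
    | cons b' l' =>
      simp only [List.length_cons, add_left_inj] at h
      have h₁ := binary_lt l
      have h₂ := binary_lt l'
      rw [List.cons_lt_cons_iff, ih h]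
      rw [h] at h₁
      simp only [binary, h]
      have : ¬ true < false := by decide
      cases b <;> cases b' <;> simp [this] <;> omega

lemma binary_inj {l l' : List Bool} (h : l.length = l'.length) (h' : binary l = binary l') :
    l = l' := by
  have h₁ := mt (lt_iff_binary_lt h).1 h'.not_lt
  have h₂ := mt (lt_iff_binary_lt h.symm).1 h'.symm.not_lt
  exact le_antisymm (not_lt.1 h₂) (not_lt.1 h₁)

lemma testBit_binary (l : List Bool) (i : ℕ) (hi : i < l.reverse.length) :
    (binary l).testBit i = l.reverse[i] := by
  induction l with
  | nil => simp at hi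
  | cons b l ih =>
    rw [binary, Nat.testBit_two_pow_mul_add _ (binary_lt l)]
    simp only [List.reverse_cons]
    split_ifs with h
    · rw [List.getElem_append_left (by simpa using h), ← ih (by simpa using h)]
    · have : i = l.length := by simp at hi; omega
      subst this
      rw [List.getElem_append_right (by simp)]
      cases b <;> simp

/-- Increment with carry: a bit flips exactly when all lower bits are 1. The lowest bit either
absorbs the increment or passes it on to `q / 2`. -/
lemma testBit_add_one_eq_true (q i : ℕ) : (q + 1).testBit i = true ↔
    ¬ (q.testBit i = true ↔ ∀ j < i, q.testBit j = true) := by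
  induction i generalizing q with
  | zero => simp [Nat.testBit_zero]; omega
  | succ i ih =>
    simp only [Nat.testBit_add_one]
    have h : (∀ j < i + 1, q.testBit j = true) ↔
        q % 2 = 1 ∧ ∀ j < i, (q / 2).testBit j = true := by
      rw [Nat.forall_lt_succ_left]
      simp [Nat.testBit_add_one]
    rw [h]
    rcases Nat.mod_two_eq_zero_or_one q with hq | hq
    · rw [show (q + 1) / 2 = q / 2 by omega]
      simp [hq]
    · rw [show (q + 1) / 2 = q / 2 + 1 by omega, ih]
      simp [hq]

/-- A carry that survives all `k` bits detects the last counter value. -/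
lemma forall_testBit_iff {q k : ℕ} (hq : q < 2 ^ k) :
    (∀ j < k, q.testBit j = true) ↔ q + 1 = 2 ^ k := by
  refine ⟨fun h => ?_, fun h j hj => ?_⟩
  · have : q = 2 ^ k - 1 := Nat.eq_of_testBit_eq fun j => by
      rw [Nat.testBit_two_pow_sub_one]
      by_cases hj : j < k
      · simp [hj, h j hj]
      · simp only [hj, decide_false]
        exact Nat.testBit_lt_two_pow (hq.trans_le (Nat.pow_le_pow_right two_pos (not_lt.1 hj)))
    have := Nat.two_pow_pos k
    omega
  · rw [show q = 2 ^ k - 1 by omega, Nat.testBit_two_pow_sub_one]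
    simpa using hj

lemma div_mod_add_one (t : ℕ) {K : ℕ} (hK : 0 < K) :
    (t % K + 1 < K ∧ (t + 1) / K = t / K ∧ (t + 1) % K = t % K + 1) ∨
      (t % K + 1 = K ∧ (t + 1) / K = t / K + 1 ∧ (t + 1) % K = 0) := by
  have h := Nat.div_add_mod t K
  have h' := Nat.mod_lt t hK
  rcases (Nat.succ_le_of_lt h').lt_or_eq with h₁ | h₁
  · exact .inl ⟨h₁, (Nat.div_mod_unique hK).2 ⟨by omega, h₁⟩⟩
  · exact .inr ⟨h₁, (Nat.div_mod_unique hK).2 ⟨by rw [mul_add]; omega, hK⟩⟩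

end ModalSubst

namespace ModalSubst

namespace Program

/-! ### Outputs under a constant slowdown -/

section Transfer

variable {P : Type u} {VAR : Type v} [LinearOrder VAR] {X : Type v} [Fintype X] [Nonempty X]

/-- If the bits of the head predicates of `Λ` in round `t / T` are those of the corresponding head
predicates of the plain program in round `t`, then both programs have the same outputs. -/
lemma outputsIn_ofEmbedding_iff {S : Finset P} {M : KripkeModel.{u, w} S}
    {acc : ℕ+ → M.W → M.W → Prop} {acc' : Unit → M.W → M.W → Prop} {Λ : Program P VAR ℕ+}
    {e : X ↪ VAR} {term : X → Formula P Unit} {body : X → Schema P X Unit}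
    (i : {Y // Y ∈ Λ.heads} ↪ X) (he : ∀ Y, e (i Y) = Y) {T : ℕ} (hT : 0 < T)
    (F : ℕ → X → M.W → Prop)
    (h₀ : ∀ Z x, M.Sat acc' x (term Z) ↔ F 0 Z x)
    (h₁ : ∀ t Z x, M.Eval acc' (F t) (body Z) x ↔ F (t + 1) Z x)
    (hF : ∀ t Y x, F t (i Y) x ↔ M.Sat acc x (Λ.iterFormula (t / T) Y))
    (x : M.W) (s : List Bool) (t : ℕ) :
    (ofEmbedding e term body (Λ.attention.map i) (Λ.print.map i)).OutputsIn M acc' x s t ↔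
      T ∣ t ∧ Λ.OutputsIn M acc x s (t / T) := by
  set Γ := ofEmbedding e term body (Λ.attention.map i) (Λ.print.map i)
  let j : {Y // Y ∈ Λ.heads} ↪ {Y // Y ∈ Γ.heads} := i.trans (headEquiv e).toEmbedding
  have hc (t : ℕ) (Y) :
      Γ.config M acc' x t (j Y) = Λ.config M acc x (t / T) Y := by
    have := (sat_iterFormula_ofEmbedding e term body (Λ.attention.map i) (Λ.print.map i) M F
      h₀ h₁ t (i Y) x).trans (hF t Y x)
    simp only [config]
    exact decide_eq_decide.2 this
  have hA : ∀ t, (∃ Z ∈ Γ.attention, Γ.config M acc' x t Z = true) ↔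
      ∃ Y ∈ Λ.attention, Λ.config M acc x (t / T) Y = true := by
    intro t
    constructor
    · rintro ⟨Z, hZ, h⟩
      obtain ⟨Z', hZ', rfl⟩ := Finset.mem_map.1 hZ
      obtain ⟨Y, hY, rfl⟩ := Finset.mem_map.1 hZ'
      exact ⟨Y, hY, (hc t Y).symm.trans h⟩
    · rintro ⟨Y, hY, h⟩
      exact ⟨j Y, Finset.mem_map_of_mem _ (Finset.mem_map_of_mem _ hY),
        (hc t Y).trans h⟩
  have hA' (b : Program P VAR ℕ+) (t : ℕ) :
      (∀ Y ∈ b.attention, b.config M acc x t Y = false) ↔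
        ¬ ∃ Y ∈ b.attention, b.config M acc x t Y = true := by simp
  have hA'' (t : ℕ) : (∀ Y ∈ Γ.attention, Γ.config M acc' x t Y = false) ↔
        ¬ ∃ Y ∈ Γ.attention, Γ.config M acc' x t Y = true := by simp
  have hP : (Γ.print.sort (· ≤ ·)).map (Γ.config M acc' x t) =
      (Λ.print.sort (· ≤ ·)).map (Λ.config M acc x (t / T)) := by
    have hp : Γ.print = Λ.print.map j := Finset.map_map _ _ _
    rw [hp, ← Finset.map_sort Λ.print (r := (· ≤ ·)) (r' := (· ≤ ·)) (f := j), List.map_map]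
    · exact List.map_congr_left fun Y _ => hc t Y
    · intro Y _ Y' _
      -- Print bits are ordered by `VAR`, and the heads of `Λ` keep their names, so the printed
      -- string is unchanged.
      change Y ≤ Y' ↔ e (i Y) ≤ e (i Y')
      rw [he, he, Subtype.coe_le_coe]
  simp only [OutputsIn, Accepts, hP, hA, hA', hA'']
  constructor
  · rintro ⟨⟨h, h'⟩, hs⟩
    -- The bits are constant on blocks of `T` rounds, so an attention bit true at `t` is already
    -- true at the start `T * (t / T)` of its block; minimality forces `t` to be that start.
    have hd : T ∣ t := by
      by_contra hd
      refine h' (T * (t / T)) ?_ ?_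
      · exact lt_of_le_of_ne (Nat.mul_div_le t T) fun h => hd ⟨_, h.symm⟩
      · rwa [Nat.mul_div_cancel_left _ hT]
    refine ⟨hd, ⟨h, fun m hm => ?_⟩, hs⟩
    have := h' (T * m) ((Nat.lt_div_iff_mul_lt' hd m).1 hm)
    rwa [Nat.mul_div_cancel_left _ hT] at this
  · rintro ⟨hd, ⟨h, h'⟩, hs⟩
    exact ⟨⟨h, fun m hm => h' _ (Nat.div_lt_div_of_lt_of_dvd hd hm)⟩, hs⟩

lemma equivalent_and_timeAtMost [LinearOrder P] {PROP₁ : Set P} {S : Finset P}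
    {Λ : Program P VAR ℕ+} {e : X ↪ VAR} {term : X → Formula P Unit}
    {body : X → Schema P X Unit} (i : {Y // Y ∈ Λ.heads} ↪ X) (he : ∀ Y, e (i Y) = Y)
    {T T' : ℕ} (hT : 0 < T) (hT' : T ≤ T')
    (h : ∀ S' : Finset P, distinguished PROP₁ S' = distinguished PROP₁ S →
      ∀ M : KripkeModel.{u, w} S', M.HasIdentifiers PROP₁ →
        ∃ F : ℕ → X → M.W → Prop, (∀ Z x, M.Sat M.plainAcc x (term Z) ↔ F 0 Z x) ∧
          (∀ t Z x, M.Eval M.plainAcc (F t) (body Z) x ↔ F (t + 1) Z x) ∧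
          ∀ t Y x, F t (i Y) x ↔
            M.Sat (M.numberedAcc PROP₁) x (Λ.iterFormula (t / T) Y)) :
    Equivalent.{u, v, w} PROP₁ S Λ
        (ofEmbedding e term body (Λ.attention.map i) (Λ.print.map i)) ∧
      TimeAtMost.{u, v, w} PROP₁ S Λ
        (ofEmbedding e term body (Λ.attention.map i) (Λ.print.map i)) T' := by
  have key (S' : Finset P) (hS : distinguished PROP₁ S' = distinguished PROP₁ S)
      (M : KripkeModel.{u, w} S') (hM : M.HasIdentifiers PROP₁) (x : M.W) (s : List Bool) (t : ℕ) :
      (ofEmbedding e term body (Λ.attention.map i) (Λ.print.map i)).OutputsIn M M.plainAcc x s t ↔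
        T ∣ t ∧ Λ.OutputsIn M (M.numberedAcc PROP₁) x s (t / T) := by
    obtain ⟨F, h₀, h₁, hF⟩ := h S' hS M hM
    exact outputsIn_ofEmbedding_iff i he hT F h₀ h₁ hF x s t
  have key' (S' : Finset P) (hS : distinguished PROP₁ S' = distinguished PROP₁ S)
      (M : KripkeModel.{u, w} S') (hM : M.HasIdentifiers PROP₁) (x : M.W) (s : List Bool) (n : ℕ)
      (hn : Λ.OutputsIn M (M.numberedAcc PROP₁) x s n) :
      (ofEmbedding e term body (Λ.attention.map i) (Λ.print.map i)).OutputsIn M M.plainAcc x s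
        (T * n) := by
    rw [key S' hS M hM, Nat.mul_div_cancel_left _ hT]
    exact ⟨dvd_mul_right _ _, hn⟩
  exact ⟨fun S' hS M hM _ _ x s => ⟨fun ⟨n, hn⟩ => ⟨_, key' S' hS M hM x s n hn⟩,
    fun ⟨t, ht⟩ => ⟨_, ((key S' hS M hM x s t).1 ht).2⟩⟩,
    fun S' hS M hM _ _ x s n hn => ⟨_, Nat.mul_le_mul_right n hT', key' S' hS M hM x s n hn⟩⟩

end Transfer

/-- Fresh names for the auxiliary predicates exist because `VAR` is infinite and `Λ.heads` finite.
-/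
lemma exists_embedding {P : Type u} {VAR : Type v} [Infinite VAR] {D : Type}
    (Λ : Program P VAR D) (E : Type) [Fintype E] :
    ∃ e : {Y // Y ∈ Λ.heads} ⊕ E ↪ VAR, ∀ Y, e (.inl Y) = Y := by
  have : Infinite ((Λ.heads : Set VAR)ᶜ : Set VAR) :=
    Set.infinite_coe_iff.2 Λ.heads.finite_toSet.infinite_compl
  let g : E ↪ ((Λ.heads : Set VAR)ᶜ : Set VAR) :=
    (Fintype.equivFin E).toEmbedding.trans (Fin.valEmbedding.trans (Infinite.natEmbedding _))
  refine ⟨⟨Sum.elim Subtype.val fun z => (g z : VAR), Function.Injective.sumElim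
    Subtype.val_injective (Subtype.val_injective.comp g.injective) fun Y z h => ?_⟩, fun _ => rfl⟩
  exact (g z).2 (h ▸ Y.2)

/-! ### No distinguished symbols: models with a single node -/

section NoIdentifiers

variable {P : Type u} {VAR : Type v} {X : Type v}

/-- The translation of schemata that is correct on models with a single node. -/
def collapse : Schema P X ℕ+ → Schema P X Unit :=
  Schema.trans .var fun i φ =>
    if i = 1 then .dia () (φ.trans .var fun _ _ => .top) else .neg .top

lemma length_collapse_le (φ : Schema P X ℕ+) : (collapse φ).length ≤ φ.length := by
  refine Schema.length_trans_le (fun _ => le_rfl) (fun i φ => ?_) φ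
  split_ifs
  · exact Nat.add_le_add_right (Schema.length_trans_le (fun _ => le_rfl)
      (fun _ _ => by simp [Schema.length]) φ) 1
  · have := φ.length_pos
    simp only [Schema.length]; omega

lemma props_collapse_subset {s : Set P} (φ : Schema P X ℕ+) (h : φ.props ⊆ s) :
    (collapse φ).props ⊆ s := by
  refine Schema.props_trans_subset (fun _ => Set.empty_subset _) (fun i φ hφ => ?_) φ h
  split_ifs
  · exact Schema.props_trans_subset (fun _ => Set.empty_subset _)
      (fun _ _ _ => Set.empty_subset _) φ hφ
  · exact Set.empty_subset _

/-- With one node no successor has a smaller identifier, so `◇₁` is the plain diamond and every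
other `◇ᵢ` is false. Depth at most 1 makes the value `.top` for nested diamonds irrelevant. -/
lemma eval_collapse [LinearOrder P] {S : Finset P} (M : KripkeModel.{u, w} S) [Subsingleton M.W] (PROP₁ : Set P)
    {ν : X → M.W → Prop} (φ : Schema P X ℕ+) (h : φ.md ≤ 1) (x : M.W) :
    M.Eval M.plainAcc ν (collapse φ) x ↔ M.Eval (M.numberedAcc PROP₁) ν φ x := by
  refine M.eval_trans φ (fun _ => Iff.rfl) fun d hd => ?_
  have hacc (i : ℕ+) (x y : M.W) : M.numberedAcc PROP₁ i x y ↔ M.R x y ∧ i = 1 := by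
    have : {z | M.R x z ∧ M.ident PROP₁ z < M.ident PROP₁ y} = ∅ := by
      ext z
      simp [Subsingleton.elim z y]
    rw [KripkeModel.numberedAcc, this, Set.ncard_empty, ← PNat.coe_eq_one_iff]
    simp [eq_comm]
  have hψ : ∀ y, M.Eval M.plainAcc ν (d.2.trans .var fun _ _ => .top) y ↔
      M.Eval (M.numberedAcc PROP₁) ν d.2 y := fun y =>
    M.eval_trans d.2 (fun _ => Iff.rfl) fun d' hd' => by
      simp [Schema.dias_eq_nil (Schema.md_of_mem_dias h d hd)] at hd'
  split_ifs with hi <;> simp [KripkeModel.Eval, hacc, hi, hψ, KripkeModel.plainAcc]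

/-- The terminal body with plain diamonds. -/
def plainTerm : Formula P ℕ+ → Schema P X Unit :=
  Schema.trans (fun Y => Y.elim) fun _ _ => .top

lemma length_plainTerm_le (φ : Formula P ℕ+) :
    (plainTerm φ : Schema P X Unit).length ≤ φ.length :=
  Schema.length_trans_le (fun Y => Y.elim) (fun _ _ => by simp [Schema.length]) φ

lemma props_plainTerm_subset {s : Set P} (φ : Formula P ℕ+) (h : φ.props ⊆ s) :
    (plainTerm φ : Schema P X Unit).props ⊆ s :=
  Schema.props_trans_subset (fun Y => Y.elim) (fun _ _ _ => Set.empty_subset _) φ h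

lemma sat_plainTerm {S : Finset P} (M : KripkeModel.{u, w} S) {acc : ℕ+ → M.W → M.W → Prop}
    {acc' : Unit → M.W → M.W → Prop} (φ : Formula P ℕ+) (h : φ.md = 0) (x : M.W) :
    M.Sat acc' x (plainTerm φ) ↔ M.Sat acc x φ := by
  rw [M.sat_iff_eval, M.sat_iff_eval]
  exact M.eval_trans φ (fun Y => Y.elim) (by simp [Schema.dias_eq_nil h])

/-- All identifiers are the empty string, so injectivity leaves one node. In this case the theorem's
time factor is `2 ^ 0`, so every round must be simulated by a single round. -/
lemma exists_plain_of_distinguished_eq_empty [LinearOrder P] [LinearOrder VAR] {PROP₁ : Set P} {S : Finset P}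
    {Λ : Program P VAR ℕ+} (hΛ : Λ.IsMPMSC) (hS : Λ.IsOver S)
    (h : distinguished PROP₁ S = ∅) {T : ℕ} (hT : 1 ≤ T) :
    ∃ Γ : Program P VAR Unit, Γ.IsMSC ∧ Γ.IsOver S ∧ Γ.length ≤ 9 * Λ.length ∧
      Equivalent.{u, v, w} PROP₁ S Λ Γ ∧ TimeAtMost.{u, v, w} PROP₁ S Λ Γ T := by
  have : Nonempty {Y // Y ∈ Λ.heads} := Λ.heads_nonempty.to_subtype
  refine ⟨ofEmbedding (Function.Embedding.subtype _) (fun Y => plainTerm (Λ.term Y))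
    (fun Y => (Λ.iter Y).flatten collapse) (Λ.attention.map (.refl _)) (Λ.print.map (.refl _)),
    isMSC_ofEmbedding _ _ _ _ _, isOver_ofEmbedding _ _ _ _ _ (fun Y => ?_) (fun Y => ?_), ?_,
    equivalent_and_timeAtMost (.refl _) (fun _ => rfl) one_pos hT ?_⟩
  · exact props_plainTerm_subset _ fun p hp => hS ⟨Y, .inl hp⟩
  · exact Clause.props_flatten_subset props_collapse_subset _ fun p hp => hS ⟨Y, .inr hp⟩
  · rw [length_ofEmbedding, length, Finset.mul_sum]
    refine Finset.sum_le_sum fun Y _ => ?_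
    have h₁ := length_plainTerm_le (X := Empty) (Λ.term Y)
    have h₂ := Clause.length_flatten_le length_collapse_le (Λ.iter Y)
    omega
  · intro S' hS' M hM
    have : Subsingleton M.W := ⟨fun x y => hM (by simp [KripkeModel.ident, hS', h])⟩
    refine ⟨fun t Y x => M.Sat (M.numberedAcc PROP₁) x (Λ.iterFormula t Y), fun Y x => ?_,
      fun t Y x => ?_, fun t Y x => by simp⟩
    · exact sat_plainTerm M _ (hΛ Y).1 x
    · simp only [iterFormula, M.sat_next]
      exact M.eval_flatten _ (fun b hb =>
        ⟨eval_collapse M PROP₁ _ (((hΛ Y).2.1 b hb).1.le.trans zero_le_one) x,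
          eval_collapse M PROP₁ _ ((hΛ Y).2.1 b hb).2 x⟩) (eval_collapse M PROP₁ _ (hΛ Y).2.2 x)

end NoIdentifiers

end Program

end ModalSubst

namespace ModalSubst

/-! ### Diamond occurrences and the program that answers them -/

namespace Program

variable {P : Type u} {VAR : Type v}

/-- The outermost diamond subschemata of the iteration clauses. -/
noncomputable def dias (Λ : Program P VAR ℕ+) :
    List (ℕ+ × Schema P {Y // Y ∈ Λ.heads} ℕ+) :=
  Finset.univ.toList.flatMap fun Y => (Λ.iter Y).dias

lemma mem_dias {Λ : Program P VAR ℕ+} {d} : d ∈ Λ.dias ↔ ∃ Y, d ∈ (Λ.iter Y).dias := by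
  simp [dias]

/-- Outermost occurrences are disjoint parts of the clauses, with `+ 1` for the diamond itself.
Hence one head predicate per occurrence, carrying a copy of its body, is affordable. -/
lemma sum_dias_le (Λ : Program P VAR ℕ+) :
    (Λ.dias.map fun d => d.2.length + 1).sum ≤ ∑ Y, (Λ.iter Y).length := by
  rw [dias, List.map_flatMap, List.flatMap_def, List.sum_flatten, List.map_map,
    Finset.sum_map_toList]
  exact Finset.sum_le_sum fun Y _ => (Λ.iter Y).sum_dias_le

lemma le_maxIndex_of_mem_dias {Λ : Program P VAR ℕ+} {d} (hd : d ∈ Λ.dias) :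
    (d.1 : ℕ) ≤ Λ.maxIndex := by
  obtain ⟨Y, hY⟩ := mem_dias.1 hd
  exact ((Λ.iter Y).le_maxIndex_of_mem_dias d hY).trans ((le_max_right _ _).trans
    (Finset.le_sup (f := fun Y => max (Λ.term Y).maxIndex (Λ.iter Y).maxIndex)
      (Finset.mem_univ Y)))

lemma md_of_mem_dias {Λ : Program P VAR ℕ+} (hΛ : Λ.IsMPMSC) {d} (hd : d ∈ Λ.dias) :
    d.2.md = 0 := by
  obtain ⟨Y, hY⟩ := mem_dias.1 hd
  simp only [Clause.dias, List.mem_append, List.mem_flatMap] at hY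
  rcases hY with ⟨b, hb, h | h⟩ | h
  · exact Schema.md_of_mem_dias (((hΛ Y).2.1 b hb).1.le.trans zero_le_one) d h
  · exact Schema.md_of_mem_dias ((hΛ Y).2.1 b hb).2 d h
  · exact Schema.md_of_mem_dias (hΛ Y).2.2 d h

/-! ### The simulating program

Every round of `Λ` is simulated by a cycle of `(k + 2) * 2 ^ k` rounds, where `k` is the number of
distinguished symbols.  All nodes run the same clock: a ring of `k + 2` phases, in each turn of
which a binary counter of `k` bits is increased by one.  In each turn the node whose identifier is
the value of the counter is active, and every node counts its active successors and stores what the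
bodies of the diamonds say about them. -/

/-- The auxiliary head predicates: the phases, the bits of the counter, the carry, the mark of the
active node, the number of neighbours seen (in unary), and the values of the `o` diamonds. -/
abbrev Aux (k I o : ℕ) : Type :=
  Fin (k + 2) ⊕ Fin k ⊕ Unit ⊕ Unit ⊕ Fin (I + 1) ⊕ Fin o

/-- The head predicates of the simulating program, for `k` distinguished symbols. -/
abbrev SimVar (Λ : Program P VAR ℕ+) (k : ℕ) : Type v :=
  {Y // Y ∈ Λ.heads} ⊕ Aux k Λ.maxIndex Λ.dias.length

section Construction

variable (Λ : Program P VAR ℕ+) (k : ℕ)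

abbrev phaseVar (p : Fin (k + 2)) : Schema P (SimVar Λ k) Unit := .var (.inr (.inl p))
abbrev bitVar (i : Fin k) : Schema P (SimVar Λ k) Unit := .var (.inr (.inr (.inl i)))
abbrev carryVar : Schema P (SimVar Λ k) Unit := .var (.inr (.inr (.inr (.inl ()))))
abbrev activeVar : Schema P (SimVar Λ k) Unit := .var (.inr (.inr (.inr (.inr (.inl ())))))
abbrev seenVar (j : Fin (Λ.maxIndex + 1)) : Schema P (SimVar Λ k) Unit :=
  .var (.inr (.inr (.inr (.inr (.inr (.inl j))))))
abbrev diaVar (o : Fin Λ.dias.length) : Schema P (SimVar Λ k) Unit :=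
  .var (.inr (.inr (.inr (.inr (.inr (.inr o))))))

/-- At least `j` neighbours have been seen, for `j` up to the maximum subindex. -/
def seen (j : ℕ) : Schema P (SimVar Λ k) Unit :=
  seenVar Λ k ⟨min j Λ.maxIndex, Nat.lt_succ_of_le (min_le_right _ _)⟩

/-- The last round of a cycle. -/
def tick : Schema P (SimVar Λ k) Unit := .and (phaseVar Λ k (Fin.last _)) (carryVar Λ k)

open Classical in
/-- The translation of schemata, the diamonds being replaced by their stored values. -/
noncomputable def simTrans :
    Schema P {Y // Y ∈ Λ.heads} ℕ+ → Schema P (SimVar Λ k) Unit :=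
  Schema.trans (fun Y => .var (.inl Y)) fun i φ =>
    -- The default is never met for diamonds of `Λ`; equal entries at several positions store the
    -- same value, so any choice will do.
    if h : ∃ o : Fin Λ.dias.length, Λ.dias[o] = (i, φ) then diaVar Λ k h.choose else .top

/-- The terminal clauses of the simulating program. -/
def simTerm : SimVar Λ k → Formula P Unit
  | .inl Y => plainTerm (Λ.term Y)
  | .inr (.inl p) => if p = 0 then .top else .neg .top
  | .inr (.inr (.inl _)) => .neg .top
  | .inr (.inr (.inr (.inl _))) => .top
  | .inr (.inr (.inr (.inr (.inl _)))) => .neg .top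
  | .inr (.inr (.inr (.inr (.inr (.inl j))))) => if j = 0 then .top else .neg .top
  | .inr (.inr (.inr (.inr (.inr (.inr _))))) => .neg .top

/-- The iteration clauses of the simulating program, `ps` being the list of the distinguished
symbols. -/
noncomputable def simBody (ps : List P) :
    SimVar Λ ps.length → Schema P (SimVar Λ ps.length) Unit
  | .inl Y => .ite (tick Λ _) ((Λ.iter Y).flatten (simTrans Λ _)) (.var (.inl Y))
  | .inr (.inl p) => Fin.cases (phaseVar Λ _ (Fin.last _)) (fun p => phaseVar Λ _ p.castSucc) p
  | .inr (.inr (.inl i)) =>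
      .neg (.iff (bitVar Λ _ i) (.and (phaseVar Λ _ i.castSucc.castSucc) (carryVar Λ _)))
  | .inr (.inr (.inr (.inl _))) =>
      -- The carry enters each turn as 1 and is killed by the first bit 0 it meets.
      .or (phaseVar Λ _ (Fin.last _)) (.and (carryVar Λ _) (.conj ((List.finRange _).map fun i =>
        .neg (.and (phaseVar Λ _ i.castSucc.castSucc) (.neg (bitVar Λ _ i))))))
  | .inr (.inr (.inr (.inr (.inl _)))) =>
      -- In phase 0 no bit has been changed yet, so the comparison is with the current counter
      -- value.
      .and (phaseVar Λ _ 0) (.conj ((List.finRange _).map fun i =>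
        .iff (bitVar Λ _ i) (.prop (ps.reverse[i.val]'(by simp)))))
  | .inr (.inr (.inr (.inr (.inr (.inl j))))) =>
      Fin.cases .top (fun j => .and (.neg (tick Λ _)) (.or (seenVar Λ _ j.succ)
        (.and (seenVar Λ _ j.castSucc) (.dia () (activeVar Λ _))))) j
  | .inr (.inr (.inr (.inr (.inr (.inr o))))) =>
      .and (.neg (tick Λ _)) (.or (diaVar Λ _ o)
        -- Exactly `i - 1` neighbours seen so far: an active successor is now the `i`th.
        (.and (.and (seen Λ _ (Λ.dias[o].1 - 1)) (.neg (seen Λ _ Λ.dias[o].1)))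
          (.dia () (.and (activeVar Λ _) (simTrans Λ _ Λ.dias[o].2)))))

/-! ### Symbols and size of the simulating program -/

variable {Λ k}

lemma length_simTrans_le (φ : Schema P {Y // Y ∈ Λ.heads} ℕ+) :
    (simTrans Λ k φ).length ≤ φ.length := by
  refine Schema.length_trans_le (fun _ => le_rfl) (fun i φ => ?_) φ
  split_ifs <;> simp [Schema.length]

lemma props_simTrans_subset {s : Set P} (φ : Schema P {Y // Y ∈ Λ.heads} ℕ+) (h : φ.props ⊆ s) :
    (simTrans Λ k φ).props ⊆ s := by
  refine Schema.props_trans_subset (fun _ => Set.empty_subset _) (fun i φ _ => ?_) φ h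
  split_ifs <;> simp [Schema.props]

lemma props_simTerm_subset {S : Finset P} (hS : Λ.IsOver S) (Z : SimVar Λ k) :
    (simTerm Λ k Z).props ⊆ S := by
  rcases Z with Y | p | i | _ | _ | j | o
  · exact props_plainTerm_subset _ fun p hp => hS ⟨Y, .inl hp⟩
  all_goals simp only [simTerm]; (try split_ifs) <;> simp [Schema.props]

lemma props_simBody_subset {S : Finset P} {ps : List P} (hS : Λ.IsOver S) (hps : ∀ p ∈ ps, p ∈ S)
    (Z : SimVar Λ ps.length) : (simBody Λ ps Z).props ⊆ S := by
  rcases Z with Y | p | i | _ | _ | j | o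
  · simp only [simBody, Schema.props_ite, tick, Schema.props, Set.empty_union, Set.union_empty]
    exact Clause.props_flatten_subset props_simTrans_subset _ fun p hp => hS ⟨Y, .inr hp⟩
  · refine Fin.cases ?_ (fun p => ?_) p <;> simp [simBody, Schema.props]
  · simp [simBody, Schema.props, Schema.props_iff]
  · simp only [simBody, Schema.or, Schema.props, Set.empty_union]
    refine Schema.props_conj_subset _ fun φ hφ => ?_
    obtain ⟨i, -, rfl⟩ := List.mem_map.1 hφ
    simp [Schema.props]
  · simp only [simBody, Schema.props, Set.empty_union]
    refine Schema.props_conj_subset _ fun φ hφ => ?_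
    obtain ⟨i, -, rfl⟩ := List.mem_map.1 hφ
    simp only [Schema.props_iff, Schema.props, Set.empty_union, Set.singleton_subset_iff]
    exact hps _ (List.mem_reverse.1 (List.getElem_mem _))
  · refine Fin.cases ?_ (fun j => ?_) j <;> simp [simBody, tick, Schema.or, Schema.props]
  · simp only [simBody, tick, seen, Schema.or, Schema.props, Set.empty_union]
    refine props_simTrans_subset _ ?_
    obtain ⟨Y, hY⟩ := mem_dias.1 (List.getElem_mem o.2)
    exact ((Λ.iter Y).props_of_mem_dias _ hY).trans fun p hp => hS ⟨Y, .inr hp⟩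

lemma sum_length_sim_le (ps : List P) :
    ∑ Z, ((1 + (simTerm Λ ps.length Z).length) + (1 + (simBody Λ ps Z).length)) ≤
      100 * (Λ.maxIndex + ps.length + Λ.length) := by
  have hsum {n c : ℕ} (f : Fin n → ℕ) (hf : ∀ i, f i ≤ c) : ∑ i, f i ≤ n * c := by
    simpa using Finset.sum_le_card_nsmul Finset.univ f c fun i _ => hf i
  simp only [Fintype.sum_sum_type, Finset.univ_unique, Finset.sum_singleton, PUnit.default_eq_unit]
  have h₁ : ∑ Y : {Y // Y ∈ Λ.heads}, ((1 + (simTerm Λ ps.length (.inl Y)).length) +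
      (1 + (simBody Λ ps (.inl Y)).length)) ≤ 20 * Λ.length := by
    rw [length, Finset.mul_sum]
    refine Finset.sum_le_sum fun Y _ => ?_
    have h₁ : (simTerm Λ ps.length (.inl Y)).length ≤ _ := length_plainTerm_le (Λ.term Y)
    have h₂ := Clause.length_flatten_le (length_simTrans_le (k := ps.length)) (Λ.iter Y)
    simp only [simBody, Schema.length_ite, tick, Schema.length]
    omega
  have h₂ : ∑ p, ((1 + (simTerm Λ ps.length (.inr (.inl p))).length) +
      (1 + (simBody Λ ps (.inr (.inl p))).length)) ≤ (ps.length + 2) * 5 := by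
    refine hsum _ fun p => Nat.add_le_add (b := 3) (d := 2) ?_ ?_
    · simp only [simTerm]; split_ifs <;> simp [Schema.length]
    · refine Fin.cases ?_ (fun p => ?_) p <;> simp [simBody, Schema.length]
  have h₃ : ∑ i, ((1 + (simTerm Λ ps.length (.inr (.inr (.inl i)))).length) +
      (1 + (simBody Λ ps (.inr (.inr (.inl i)))).length)) ≤ ps.length * 20 := by
    refine hsum _ fun p => ?_
    simp [simTerm, simBody, Schema.length, Schema.length_iff]
  have h₄ : ((1 + (simTerm Λ ps.length (.inr (.inr (.inr (.inl PUnit.unit))))).length) +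
      (1 + (simBody Λ ps (.inr (.inr (.inr (.inl PUnit.unit))))).length)) ≤ 6 * ps.length + 11 := by
    have := Schema.length_conj_le (c := 5) ((List.finRange ps.length).map fun i =>
      .neg (.and (phaseVar Λ _ i.castSucc.castSucc) (.neg (bitVar Λ _ i)))) (by
        simp [Schema.length])
    simp only [List.length_map, List.length_finRange] at this
    simp only [simTerm, simBody, Schema.length, Schema.length_or]
    omega
  have h₅ : ((1 + (simTerm Λ ps.length (.inr (.inr (.inr (.inr (.inl PUnit.unit)))))).length) +
      (1 + (simBody Λ ps (.inr (.inr (.inr (.inr (.inl PUnit.unit)))))).length)) ≤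
      12 * ps.length + 8 := by
    have := Schema.length_conj_le (c := 11) ((List.finRange ps.length).map fun i =>
      .iff (bitVar Λ _ i) (.prop (ps.reverse[i.val]'(by simp)))) (by
        simp [Schema.length, Schema.length_iff])
    simp only [List.length_map, List.length_finRange] at this
    simp only [simTerm, simBody, Schema.length]
    omega
  have h₆ : ∑ j, ((1 + (simTerm Λ ps.length (.inr (.inr (.inr (.inr (.inr (.inl j))))))).length) +
      (1 + (simBody Λ ps (.inr (.inr (.inr (.inr (.inr (.inl j))))))).length)) ≤
      (Λ.maxIndex + 1) * 18 := by
    refine hsum _ fun j => Nat.add_le_add (b := 3) (d := 15) ?_ ?_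
    · simp only [simTerm]; split_ifs <;> simp [Schema.length]
    · refine Fin.cases ?_ (fun p => ?_) j <;>
        simp [simBody, tick, Schema.length, Schema.length_or]
  have h₇ : ∑ o, ((1 + (simTerm Λ ps.length (.inr (.inr (.inr (.inr (.inr (.inr o))))))).length) +
      (1 + (simBody Λ ps (.inr (.inr (.inr (.inr (.inr (.inr o))))))).length)) ≤
      25 * Λ.length := by
    calc _ ≤ ∑ o : Fin Λ.dias.length, 25 * (Λ.dias[o.val].2.length + 1) := by
          refine Finset.sum_le_sum fun o _ => ?_
          have := length_simTrans_le (k := ps.length) Λ.dias[o].2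
          simp only [simTerm, simBody, tick, seen, Schema.length, Schema.length_or,
            Fin.getElem_fin] at this ⊢
          omega
      _ = 25 * (Λ.dias.map fun d => d.2.length + 1).sum := by
          rw [← Finset.mul_sum, ← Fin.sum_univ_fun_getElem]
      _ ≤ 25 * Λ.length := by
          refine Nat.mul_le_mul_left _ (Λ.sum_dias_le.trans (Finset.sum_le_sum fun Y _ => ?_))
          omega
  -- The constant terms of the bounds above add up to 47 and are charged to `Λ.length`.
  have h₈ : 1 ≤ Λ.length := by
    obtain ⟨Y, hY⟩ := Λ.heads_nonempty
    have := Finset.single_le_sum (f := fun Y =>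
      ((1 + (Λ.term Y).length) + (1 + (Λ.iter Y).length))) (fun _ _ => Nat.zero_le _)
      (Finset.mem_univ (⟨Y, hY⟩ : {Y // Y ∈ Λ.heads}))
    rw [length]
    omega
  omega

end Construction

end Program

end ModalSubst

namespace ModalSubst

/-! ### Counting neighbours by numerical identifiers -/

namespace KripkeModel

variable {P : Type u} [LinearOrder P] {S : Finset P} (M : KripkeModel.{u, w} S) (PROP₁ : Set P)

/-- The identifier as a binary number. -/
noncomputable def num (x : M.W) : ℕ := binary (M.ident PROP₁ x)

/-- The number of successors whose identifiers are less than `c`. -/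
noncomputable def below (x : M.W) (c : ℕ) : ℕ := {z | M.R x z ∧ M.num PROP₁ z < c}.ncard

variable {M PROP₁}

lemma length_ident (x : M.W) : (M.ident PROP₁ x).length = (distinguished PROP₁ S).card := by
  simp [ident]

lemma num_lt (x : M.W) : M.num PROP₁ x < 2 ^ (distinguished PROP₁ S).card :=
  (binary_lt _).trans_eq (by rw [length_ident])

lemma HasIdentifiers.num_injective (hM : M.HasIdentifiers PROP₁) :
    Function.Injective (M.num PROP₁) := fun x y h =>
  hM (binary_inj (by simp only [length_ident]) h)

lemma HasIdentifiers.finite (hM : M.HasIdentifiers PROP₁) : Finite M.W :=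
  Finite.of_injective (fun x => (⟨M.num PROP₁ x, num_lt x⟩ : Fin _))
    fun _ _ h => hM.num_injective (congrArg Fin.val h)

lemma numberedAcc_iff (i : ℕ+) (x y : M.W) :
    M.numberedAcc PROP₁ i x y ↔ M.R x y ∧ M.below PROP₁ x (M.num PROP₁ y) + 1 = i := by
  simp only [numberedAcc, below, num, ← lt_iff_binary_lt
    ((length_ident (PROP₁ := PROP₁) _).trans (length_ident (PROP₁ := PROP₁) y).symm)]

lemma below_zero (x : M.W) : M.below PROP₁ x 0 = 0 := by simp [below]

/-- At most one successor has the number `c`, so the count grows by at most one. The form is that of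
the update of the unary counter. -/
lemma HasIdentifiers.le_below_add_one (hM : M.HasIdentifiers PROP₁) (x : M.W) (c j : ℕ) :
    j + 1 ≤ M.below PROP₁ x (c + 1) ↔ j + 1 ≤ M.below PROP₁ x c ∨
      (j ≤ M.below PROP₁ x c ∧ ∃ z, M.R x z ∧ M.num PROP₁ z = c) := by
  have := hM.finite
  by_cases h : ∃ z, M.R x z ∧ M.num PROP₁ z = c
  · obtain ⟨z, hz, hc⟩ := h
    have h₁ : {y | M.R x y ∧ M.num PROP₁ y < c + 1} =
        insert z {y | M.R x y ∧ M.num PROP₁ y < c} := by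
      ext y
      simp only [Set.mem_ofPred_eq, Set.mem_insert_iff, Nat.lt_succ_iff_lt_or_eq]
      constructor
      · rintro ⟨hy, h | h⟩
        exacts [.inr ⟨hy, h⟩, .inl (hM.num_injective (h.trans hc.symm))]
      · rintro (rfl | ⟨hy, h⟩)
        exacts [⟨hz, .inr hc⟩, ⟨hy, .inl h⟩]
    have h₂ : M.below PROP₁ x (c + 1) = M.below PROP₁ x c + 1 := by
      rw [below, h₁, Set.ncard_insert_of_notMem (by simp [hc]) (Set.toFinite _), below]
    have h₃ : ∃ z, M.R x z ∧ M.num PROP₁ z = c := ⟨z, hz, hc⟩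
    simp only [h₂, h₃, and_true]
    omega
  · have h₁ : M.below PROP₁ x (c + 1) = M.below PROP₁ x c := by
      refine congrArg Set.ncard (Set.ext fun y => and_congr_right fun hy => ?_)
      have : M.num PROP₁ y ≠ c := fun hc => h ⟨y, hy, hc⟩
      omega
    simp [h₁, h]

/-- The test by which a node recognises itself in the counter. Bit 0 belongs to the last symbol,
hence the reversal. -/
lemma num_eq_iff (x : M.W) {q : ℕ} (hq : q < 2 ^ (distinguished PROP₁ S).card) :
    M.num PROP₁ x = q ↔ ∀ i : Fin ((distinguished PROP₁ S).sort (· ≤ ·)).length,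
      (q.testBit i = true ↔
        M.Holds x (((distinguished PROP₁ S).sort (· ≤ ·)).reverse[i.val]'(by simpa using i.2))) := by
  classical
  have hb (i : ℕ) (hi : i < ((distinguished PROP₁ S).sort (· ≤ ·)).length) :
      (M.num PROP₁ x).testBit i = true ↔
        M.Holds x (((distinguished PROP₁ S).sort (· ≤ ·)).reverse[i]'(by simpa using hi)) := by
    rw [num, testBit_binary _ _ (by simpa [length_ident] using hi)]
    simp only [ident, ← List.map_reverse, List.getElem_map, decide_eq_true_eq]
  constructor
  · rintro rfl i
    exact hb i i.2
  · intro h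
    refine Nat.eq_of_testBit_eq fun i => ?_
    by_cases hi : i < ((distinguished PROP₁ S).sort (· ≤ ·)).length
    · exact Bool.eq_iff_iff.2 ((hb i hi).trans (h ⟨i, hi⟩).symm)
    · have hi' : 2 ^ (distinguished PROP₁ S).card ≤ 2 ^ i :=
        Nat.pow_le_pow_right two_pos (by simpa using hi)
      rw [Nat.testBit_lt_two_pow ((num_lt x).trans_le hi'),
        Nat.testBit_lt_two_pow (hq.trans_le hi')]

end KripkeModel

/-! ### The clock -/

namespace Program

variable {P : Type u} {VAR : Type v}

/-- `(n', q', r')` is the time after `(n, q, r)`: `n` is the simulated round, `q` the value of the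
counter and `r` the phase. -/
def ClockStep (k n q r n' q' r' : ℕ) : Prop :=
  (r < k + 1 ∧ n' = n ∧ q' = q ∧ r' = r + 1) ∨
  (r = k + 1 ∧ q + 1 < 2 ^ k ∧ n' = n ∧ q' = q + 1 ∧ r' = 0) ∨
  (r = k + 1 ∧ q + 1 = 2 ^ k ∧ n' = n + 1 ∧ q' = 0 ∧ r' = 0)

/-- The round number in mixed radix: the phase is the lowest digit, to base `k + 2`, and the counter
the next one, to base `2 ^ k`. -/
lemma clockStep_div_mod (k t : ℕ) :
    ClockStep k (t / (k + 2) / 2 ^ k) (t / (k + 2) % 2 ^ k) (t % (k + 2))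
      ((t + 1) / (k + 2) / 2 ^ k) ((t + 1) / (k + 2) % 2 ^ k) ((t + 1) % (k + 2)) := by
  rcases div_mod_add_one t (K := k + 2) (by omega) with ⟨h₁, h₂, h₃⟩ | ⟨h₁, h₂, h₃⟩
  · exact .inl ⟨by omega, by rw [h₂], by rw [h₂], h₃⟩
  · rcases div_mod_add_one (t / (k + 2)) (K := 2 ^ k) (by positivity) with
      ⟨h₄, h₅, h₆⟩ | ⟨h₄, h₅, h₆⟩
    · exact .inr (.inl ⟨by omega, h₄, by rw [h₂, h₅], by rw [h₂, h₆], h₃⟩)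
    · exact .inr (.inr ⟨by omega, h₄, by rw [h₂, h₅], by rw [h₂, h₆], h₃⟩)

/-- The identifiers less than this number have been treated at phase `r` of the turn with counter
value `q`. -/
def treated (q r : ℕ) : ℕ := q + if 2 ≤ r then 1 else 0

/-! ### The invariant and its preservation -/

section Simulation

variable [LinearOrder P] {S : Finset P} (M : KripkeModel.{u, w} S) (PROP₁ : Set P)
  (Λ : Program P VAR ℕ+)

/-- The meaning of the head predicates of the simulating program at the time `(n, q, r)`. -/
def simState (k n q r : ℕ) : SimVar Λ k → M.W → Prop
  | .inl Y, x => M.Sat (M.numberedAcc PROP₁) x (Λ.iterFormula n Y)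
  | .inr (.inl p), _ => r = p
  | .inr (.inr (.inl i)), _ => (if i.val < r then q + 1 else q).testBit i = true
  | .inr (.inr (.inr (.inl _))), _ => ∀ j < k, j < r → q.testBit j = true
  | .inr (.inr (.inr (.inr (.inl _)))), x => r = 1 ∧ M.num PROP₁ x = q
  | .inr (.inr (.inr (.inr (.inr (.inl j))))), x => j.val ≤ M.below PROP₁ x (treated q r)
  | .inr (.inr (.inr (.inr (.inr (.inr o))))), x =>
      ∃ y, M.numberedAcc PROP₁ Λ.dias[o].1 x y ∧ M.num PROP₁ y < treated q r ∧
        M.Eval (M.numberedAcc PROP₁) (fun Y y => M.Sat (M.numberedAcc PROP₁) y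
          (Λ.iterFormula n Y)) Λ.dias[o].2 y

variable {M PROP₁ Λ} {k n q r : ℕ} {x : M.W}

/-- In the last phase the carry has passed all `k` bits, so it signals the overflow of the counter.
-/
lemma eval_tick (hq : q < 2 ^ k) :
    M.Eval M.plainAcc (simState M PROP₁ Λ k n q r) (tick Λ k) x ↔ r = k + 1 ∧ q + 1 = 2 ^ k := by
  simp only [tick, KripkeModel.Eval, simState, Fin.val_last, ← forall_testBit_iff hq]
  refine and_congr_right fun h => forall₂_congr fun j hj => ?_
  simp [h, hj.trans (Nat.lt_succ_self k)]

lemma eval_seen {j : ℕ} (hj : j ≤ Λ.maxIndex) :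
    M.Eval M.plainAcc (simState M PROP₁ Λ k n q r) (seen Λ k j) x ↔
      j ≤ M.below PROP₁ x (treated q r) := by
  simp [seen, KripkeModel.Eval, simState, hj]

lemma eval_simTrans_of_md_eq_zero {φ : Schema P {Y // Y ∈ Λ.heads} ℕ+} (h : φ.md = 0) :
    M.Eval M.plainAcc (simState M PROP₁ Λ k n q r) (simTrans Λ k φ) x ↔
      M.Eval (M.numberedAcc PROP₁) (fun Y y => M.Sat (M.numberedAcc PROP₁) y
          (Λ.iterFormula n Y)) φ x :=
  M.eval_trans φ (fun _ => Iff.rfl) (by simp [Schema.dias_eq_nil h])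

/-- All identifiers lie below `2 ^ k`, so by now every neighbour has been asked and the stored bits
are the diamonds. -/
lemma eval_simTrans_of_treated_eq (hk : k = (distinguished PROP₁ S).card)
    (ht : treated q r = 2 ^ k) {φ : Schema P {Y // Y ∈ Λ.heads} ℕ+} (h : ∀ d ∈ φ.dias, d ∈ Λ.dias) :
    M.Eval M.plainAcc (simState M PROP₁ Λ k n q r) (simTrans Λ k φ) x ↔
      M.Eval (M.numberedAcc PROP₁) (fun Y y => M.Sat (M.numberedAcc PROP₁) y
          (Λ.iterFormula n Y)) φ x := by
  refine M.eval_trans φ (fun _ => Iff.rfl) fun d hd => ?_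
  have hex : ∃ o : Fin Λ.dias.length, Λ.dias[o] = d := by
    obtain ⟨o, ho, h⟩ := List.getElem_of_mem (h d hd)
    exact ⟨⟨o, ho⟩, h⟩
  rw [dif_pos hex]
  simp only [KripkeModel.Eval, simState, ht]
  rw [hex.choose_spec]
  refine exists_congr fun y => and_congr_right fun _ => and_iff_right ?_
  rw [hk]
  exact KripkeModel.num_lt y

lemma sat_simTerm (hΛ : Λ.IsMPMSC) (Z : SimVar Λ k) (x : M.W) :
    M.Sat M.plainAcc x (simTerm Λ k Z) ↔ simState M PROP₁ Λ k 0 0 0 Z x := by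
  rcases Z with Y | p | i | _ | _ | j | o
  · exact sat_plainTerm M _ (hΛ Y).1 x
  · have hp : 0 = p.val ↔ p = 0 := by rw [Fin.ext_iff, eq_comm]; rfl
    simp only [simTerm, simState, hp]
    split_ifs with h <;> simp [KripkeModel.Sat, h]
  · simp [simTerm, simState, KripkeModel.Sat]
  · simp [simTerm, simState, KripkeModel.Sat]
  · simp [simTerm, simState, KripkeModel.Sat]
  · have hj : j.val = 0 ↔ j = 0 := by rw [Fin.ext_iff]; rfl
    have ht : treated 0 0 = 0 := rfl
    simp only [simTerm, simState, ht, KripkeModel.below_zero, Nat.le_zero, hj]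
    split_ifs with h <;> simp [KripkeModel.Sat, h]
  · simp [simTerm, simState, KripkeModel.Sat, treated]

variable {n' q' r' : ℕ}

/-- The heart of the correctness proof: one round of the program is one step of the clock. `1 ≤
ps.length` separates phase 1, when the active node is visible, from the last phase, when the tick
may come. -/
lemma eval_simBody (hΛ : Λ.IsMPMSC) (hM : M.HasIdentifiers PROP₁) {ps : List P}
    (hps : ps = (distinguished PROP₁ S).sort (· ≤ ·)) (hk : 1 ≤ ps.length)
    (hq : q < 2 ^ ps.length) (h : ClockStep ps.length n q r n' q' r')
    (Z : SimVar Λ ps.length) (x : M.W) :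
    M.Eval M.plainAcc (simState M PROP₁ Λ ps.length n q r) (simBody Λ ps Z) x ↔
      simState M PROP₁ Λ ps.length n' q' r' Z x := by
  have hcard : ps.length = (distinguished PROP₁ S).card := by simp [hps]
  have htick (x : M.W) := eval_tick (M := M) (PROP₁ := PROP₁) (Λ := Λ) (n := n) (r := r) (x := x) hq
  -- The bound moves only on leaving phase 1 and at the tick; on passing to the next counter value,
  -- the increase of `q` replaces the summand 1.
  have htr : treated q' r' = if r = ps.length + 1 ∧ q + 1 = 2 ^ ps.length then 0 else
      if r = 1 then treated q r + 1 else treated q r := by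
    unfold treated
    rcases h with ⟨h, -, rfl, rfl⟩ | ⟨rfl, h, -, rfl, rfl⟩ | ⟨rfl, h, -, rfl, rfl⟩ <;>
      split_ifs <;> omega
  have htr₁ : r = 1 → treated q r = q := fun h => by simp [treated, h]
  rcases Z with Y | p | i | _ | _ | j | o
  · simp only [simBody, KripkeModel.eval_ite, htick]
    simp only [KripkeModel.Eval]
    by_cases hc : r = ps.length + 1 ∧ q + 1 = 2 ^ ps.length
    · have hn : n' = n + 1 := by unfold ClockStep at h; omega
      -- The last phase is at least 2, so even the last counter value has been treated.
      have ht : treated q r = 2 ^ ps.length := by unfold treated; split_ifs <;> omega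
      subst hn
      refine (or_iff_left fun h => h.1 hc).trans ((and_iff_right hc).trans ?_)
      simp only [simState, iterFormula, M.sat_next]
      have hmem : ∀ d ∈ (Λ.iter Y).dias, d ∈ Λ.dias := fun d hd => mem_dias.2 ⟨Y, hd⟩
      simp only [Clause.dias, List.mem_append, List.mem_flatMap] at hmem
      refine M.eval_flatten _ (fun b hb => ⟨?_, ?_⟩) ?_
      · exact eval_simTrans_of_treated_eq hcard ht fun d hd => hmem d (.inl ⟨b, hb, .inl hd⟩)
      · exact eval_simTrans_of_treated_eq hcard ht fun d hd => hmem d (.inl ⟨b, hb, .inr hd⟩)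
      · exact eval_simTrans_of_treated_eq hcard ht fun d hd => hmem d (.inr hd)
    · have hn : n' = n := by unfold ClockStep at h; omega
      simp [hc, hn, simState]
  · simp only [simBody]
    refine Fin.cases ?_ (fun p => ?_) p
    · simp only [Fin.cases_zero, KripkeModel.Eval, simState, Fin.val_last, Fin.val_zero]
      unfold ClockStep at h; omega
    · simp only [Fin.cases_succ, KripkeModel.Eval, simState, Fin.val_castSucc, Fin.val_succ]
      have := p.2
      unfold ClockStep at h; omega
  · simp only [simBody, KripkeModel.Eval, KripkeModel.eval_iff, simState, Fin.val_castSucc]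
    have hi := i.2
    rcases h with ⟨h, -, rfl, rfl⟩ | ⟨rfl, h, -, rfl, rfl⟩ | ⟨rfl, h, -, rfl, rfl⟩
    · rcases lt_trichotomy i.val r with h' | h' | h'
      · simp [h', h'.ne', h'.trans (Nat.lt_succ_self r)]
      · subst h'
        simp only [lt_irrefl, if_false, Nat.lt_succ_self, if_true, true_and,
          testBit_add_one_eq_true]
        refine not_congr (iff_congr Iff.rfl ⟨fun h j hj => h j (hj.trans hi) hj,
          fun h j _ hj => h j hj⟩)
      · simp [h'.ne, h'.not_gt, show ¬ i.val < r + 1 by omega]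
    · have h₁ : i.val < ps.length + 1 := by omega
      have h₂ : ps.length + 1 ≠ i.val := by omega
      simp [h₁, h₂]
    · have h₁ : i.val < ps.length + 1 := by omega
      have h₂ : ps.length + 1 ≠ i.val := by omega
      -- Overflow: below position `k` the numbers `2 ^ k` and `0` have the same bits.
      simp [h₁, h₂, h, hi.ne']
  · simp only [simBody, KripkeModel.eval_or, KripkeModel.Eval, KripkeModel.eval_conj, simState,
      Fin.val_last, List.mem_map, List.mem_finRange, true_and, forall_exists_index,
      forall_apply_eq_imp_iff, Fin.val_castSucc]
    rcases h with ⟨h, -, rfl, rfl⟩ | ⟨rfl, h, -, rfl, rfl⟩ | ⟨rfl, h, -, rfl, rfl⟩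
    · constructor
      · rintro (h' | ⟨h₁, h₂⟩) j hj hjr
        · omega
        · rcases (Nat.lt_succ_iff_lt_or_eq.1 hjr) with h' | rfl
          · exact h₁ j hj h'
          -- Bit `j` is read in phase `j`, before its change shows, so it is still the bit of `q`.
          · simpa using h₂ ⟨j, hj⟩
      · refine fun h' => .inr ⟨fun j hj hjr => h' j hj (hjr.trans (Nat.lt_succ_self r)), ?_⟩
        rintro i ⟨rfl, hi⟩
        exact hi (by simpa using h' i i.2 (Nat.lt_succ_self _))
    · simp
    · simp
  · simp only [simBody, KripkeModel.Eval, KripkeModel.eval_conj, simState, Fin.val_zero,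
      List.mem_map, List.mem_finRange, true_and, forall_exists_index, forall_apply_eq_imp_iff,
      KripkeModel.eval_iff]
    subst hps
    have hx := KripkeModel.num_eq_iff (M := M) (PROP₁ := PROP₁) x (q := q) (by rwa [← hcard])
    by_cases hr : r = 0
    · have : r' = 1 ∧ q' = q := by unfold ClockStep at h; omega
      simp [hr, this, hx]
    · have : r' ≠ 1 := by unfold ClockStep at h; omega
      simp [hr, this]
  · simp only [simBody]
    refine Fin.cases ?_ (fun j => ?_) j
    · simp [KripkeModel.Eval, simState]
    · simp only [Fin.cases_succ, KripkeModel.Eval, KripkeModel.eval_or, htick, simState,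
        Fin.val_succ, Fin.val_castSucc]
      by_cases hc : r = ps.length + 1 ∧ q + 1 = 2 ^ ps.length
      · rw [if_pos hc] at htr
        simp [hc, htr, KripkeModel.below_zero]
      · by_cases hr : r = 1
        · rw [if_neg hc, if_pos hr, htr₁ hr] at htr
          rw [and_iff_right hc, htr, htr₁ hr, hM.le_below_add_one]
          simp only [hr, true_and, KripkeModel.plainAcc]
        · rw [if_neg hc, if_neg hr] at htr
          simp [hc, hr, htr]
  · simp only [simBody, KripkeModel.Eval, KripkeModel.eval_or, htick]
    have hmem : Λ.dias[o] ∈ Λ.dias := List.getElem_mem o.2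
    have hi := le_maxIndex_of_mem_dias hmem
    have hi₁ := Λ.dias[o].1.pos
    rw [eval_seen hi, eval_seen ((Nat.sub_le _ _).trans hi)]
    simp only [eval_simTrans_of_md_eq_zero (md_of_mem_dias hΛ hmem), simState]
    by_cases hc : r = ps.length + 1 ∧ q + 1 = 2 ^ ps.length
    · rw [if_pos hc] at htr
      simp [hc, htr]
    · have hn : n' = n := by unfold ClockStep at h; omega
      subst hn
      by_cases hr : r = 1
      · rw [if_neg hc, if_pos hr, htr₁ hr] at htr
        rw [and_iff_right hc, htr, htr₁ hr]
        simp only [hr, true_and, Nat.lt_succ_iff_lt_or_eq, KripkeModel.numberedAcc_iff,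
          KripkeModel.plainAcc]
        -- A neighbour numbered below `q` is already stored; one numbered `q` is the active
        -- successor, and the two bounds on the count say that it is the `i`th.
        constructor
        · rintro (⟨y, h₁, h₂, h₃⟩ | ⟨⟨h₁, h₂⟩, y, h₃, h₄, h₅⟩)
          · exact ⟨y, h₁, .inl h₂, h₃⟩
          · exact ⟨y, ⟨h₃, by rw [h₄]; omega⟩, .inr h₄, h₅⟩
        · rintro ⟨y, ⟨h₁, h₂⟩, h₃ | h₃, h₄⟩
          · exact .inl ⟨y, ⟨h₁, h₂⟩, h₃, h₄⟩
          · rw [h₃] at h₂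
            exact .inr ⟨⟨by omega, by omega⟩, y, h₁, h₃, h₄⟩
      · rw [if_neg hc, if_neg hr] at htr
        simp [hc, hr, htr]

end Simulation

end Program

/-! ### Assembly and the constant 100 -/

open Program in
theorem exists_simulating_program (PROP : Type u) [LinearOrder PROP] (PROP₁ : Set PROP)
    (VAR : Type v) [LinearOrder VAR] [Infinite VAR] (S : Finset PROP) (Λ : Program PROP VAR ℕ+)
    (hΛ : Λ.IsMPMSC) (hS : Λ.IsOver S) :
    ∃ Γ : Program PROP VAR Unit, Γ.IsMSC ∧ Γ.IsOver S ∧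
      Γ.length ≤ 100 * (Λ.maxIndex + (distinguished PROP₁ S).card + Λ.length) ∧
      Equivalent.{u, v, w} PROP₁ S Λ Γ ∧
      TimeAtMost.{u, v, w} PROP₁ S Λ Γ (2 ^ (100 * (distinguished PROP₁ S).card)) := by
  rcases (distinguished PROP₁ S).eq_empty_or_nonempty with h | h
  · obtain ⟨Γ, h₁, h₂, h₃, h₄, h₅⟩ := exists_plain_of_distinguished_eq_empty
      (T := 2 ^ (100 * (distinguished PROP₁ S).card)) hΛ hS h Nat.one_le_two_pow
    exact ⟨Γ, h₁, h₂, by omega, h₄, h₅⟩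
  set ps := (distinguished PROP₁ S).sort (· ≤ ·) with hps
  have hk : ps.length = (distinguished PROP₁ S).card := by simp [hps]
  have hk₁ : 1 ≤ ps.length := hk ▸ h.card_pos
  have hpsS : ∀ p ∈ ps, p ∈ S := fun p hp => by
    simp only [hps, Finset.mem_sort, distinguished, Finset.mem_filter] at hp
    exact hp.1
  obtain ⟨e, he⟩ := Λ.exists_embedding (Aux ps.length Λ.maxIndex Λ.dias.length)
  refine ⟨ofEmbedding e (simTerm Λ ps.length) (simBody Λ ps) (Λ.attention.map .inl)
    (Λ.print.map .inl), isMSC_ofEmbedding _ _ _ _ _,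
    isOver_ofEmbedding _ _ _ _ _ (props_simTerm_subset hS) (props_simBody_subset hS hpsS), ?_,
    equivalent_and_timeAtMost .inl he (T := (ps.length + 2) * 2 ^ ps.length) (by positivity) ?_
      fun S' hS' M hM => ?_⟩
  · rw [length_ofEmbedding, ← hk]
    exact sum_length_sim_le ps
  · rw [← hk]
    calc (ps.length + 2) * 2 ^ ps.length
        ≤ 2 ^ (ps.length + 2) * 2 ^ ps.length :=
          Nat.mul_le_mul_right _ Nat.lt_two_pow_self.le
      _ = 2 ^ (ps.length + 2 + ps.length) := (pow_add _ _ _).symm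
      -- `2k + 2 ≤ 100k` holds because `k ≥ 1`.
      _ ≤ _ := Nat.pow_le_pow_right two_pos (by omega)
  · rw [← hS'] at hps
    refine ⟨fun t => simState M PROP₁ Λ ps.length (t / (ps.length + 2) / 2 ^ ps.length)
      (t / (ps.length + 2) % 2 ^ ps.length) (t % (ps.length + 2)), fun Z x => ?_,
      fun t Z x => ?_, fun t Y x => ?_⟩
    · simpa using sat_simTerm hΛ Z x
    · exact eval_simBody hΛ hM hps hk₁ (Nat.mod_lt _ (by positivity)) (clockStep_div_mod _ t) Z x
    · rw [← Nat.div_div_eq_div_mul]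
      exact Iff.rfl

end ModalSubst

theorem mainTheorem5 :
    ∃ C : ℕ, ∀ (PROP : Type u) [LinearOrder PROP] (PROP₁ : Set PROP)
      (VAR : Type v) [LinearOrder VAR] [Infinite VAR]
      (S : Finset PROP) (Λ : ModalSubst.Program PROP VAR ℕ+),
      Λ.IsMPMSC → Λ.IsOver S →
      ∃ Γ : ModalSubst.Program PROP VAR Unit,
        Γ.IsMSC ∧ Γ.IsOver S ∧
        Γ.length ≤ C * (Λ.maxIndex + (ModalSubst.distinguished PROP₁ S).card + Λ.length) ∧
        ModalSubst.Program.Equivalent.{u, v, w} PROP₁ S Λ Γ ∧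
        ModalSubst.Program.TimeAtMost.{u, v, w} PROP₁ S Λ Γ
          (2 ^ (C * (ModalSubst.distinguished PROP₁ S).card)) :=
  ⟨100, ModalSubst.exists_simulating_program⟩
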